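/- Theorem. Let $n \ge 4$ and let $W_n$ be the wheel graph on $n$ vertices: its vertex set is $\mathbb{Z}/(n-1)\mathbb{Z} \sqcup \{v\}$ and its edges are $\{i,i+1\}$ and $\{i,v\}$ for $i \in \mathbb{Z}/(n-1)\mathbb{Z}$. Write $E$ for its edge set. A matching on $W_n$ is a set $m\subseteq E$ such that every vertex is incident to at most one edge of $m$. Let $P_M(W_n) \subseteq \mathbb{R}^{E}$ be the matching polytope of $W_n$, that is, the convex hull of the indicator vectors of the matchings on $W_n$. Then the lattice polytope $P_M(W_n)$ has the integer decomposition property: for every integer $t \ge 1$ and every $\alpha \in tP_M(W_n) \cap \mathbb{Z}^{E}$ there exist $\alpha_1, \dots, \alpha_t \in P_M(W_n) \cap \mathbb{Z}^{E}$ with $\alpha = \alpha_1 + \cdots + \alpha_t$. -/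

import Mathlib

open scoped Pointwise

/-- The point of `ℝ^ι` with integer coordinates `a`. -/
def latticePoint {ι : Type*} (a : ι → ℤ) : ι → ℝ := fun i => (a i : ℝ)

/-- A lattice polytope: the convex hull of finitely many integer points. -/
def IsLatticePolytope {ι : Type*} (P : Set (ι → ℝ)) : Prop :=
  ∃ S : Set (ι → ℤ), S.Finite ∧ P = convexHull ℝ (latticePoint '' S)

/-- A lattice polytope `P` has the integer decomposition property if, for every integer `t ≥ 1`,
every integer point of the dilate `tP` is a sum of `t` integer points of `P`. -/
def HasIDP {ι : Type*} (P : Set (ι → ℝ)) : Prop :=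
  IsLatticePolytope P ∧
    ∀ t : ℕ, 0 < t → ∀ a : ι → ℤ, latticePoint a ∈ (t : ℝ) • P →
      ∃ b : Fin t → ι → ℤ, (∀ k, latticePoint (b k) ∈ P) ∧ a = ∑ k, b k

/-- A set of edges of `G` is a matching if every vertex is incident to at most one of them. -/
def IsEdgeMatching {V : Type*} (G : SimpleGraph V) (m : Set G.edgeSet) : Prop :=
  ∀ u : V, ∀ e ∈ m, ∀ f ∈ m, u ∈ (e : Sym2 V) → u ∈ (f : Sym2 V) → e = f

/-- The indicator vector in `ℝ^E` of a set of edges. -/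
noncomputable def edgeIndicator {V : Type*} (G : SimpleGraph V) (m : Set G.edgeSet) :
    G.edgeSet → ℝ :=
  m.indicator (fun _ => 1)

/-- The matching polytope: the convex hull in `ℝ^E` of the indicator vectors of all matchings. -/
def matchingPolytope {V : Type*} (G : SimpleGraph V) : Set (G.edgeSet → ℝ) :=
  convexHull ℝ {x | ∃ m : Set G.edgeSet, IsEdgeMatching G m ∧ x = edgeIndicator G m}

/-- The wheel graph on `n ≥ 4` vertices: the rim vertices are `Sum.inl i` with `i : ℤ/(n-1)`, the
centre is `Sum.inr ()`, and the edges are the rim edges `{i, i + 1}` and the spokes `{i, centre}`. -/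
def wheelGraph (n : ℕ) : SimpleGraph (ZMod (n - 1) ⊕ Unit) :=
  SimpleGraph.fromEdgeSet
    {e | ∃ i : ZMod (n - 1), e = s(Sum.inl i, Sum.inl (i + 1)) ∨ e = s(Sum.inl i, Sum.inr ())}

/-! An integer point of the `t`-th dilate gives multiplicities `r` on the rim edges and `s` on the
spokes, and a decomposition into `t` matchings is a proper edge colouring of this multigraph with
`t` colours. Only inequalities valid for every matching are needed, not a full facet description:
the degree bounds at the rim and at the centre, the bound for the rim cycle, and the odd-set bounds
for the centre together with an even number of consecutive rim vertices (possibly all of them).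

The rim alone is coloured by cyclic intervals of colours (`exists_rim_colouring`). The spokes are
added by Kempe interchanges (`exists_colouring_of_rim`). In a colouring with the most coloured
spokes, suppose that a copy of the spoke at `i` is uncoloured, `β` is missing at the centre and `α`
is missing at `i`. Maximality forces the `α`-`β` chain from `i` to end at the spoke of colour `α`.
Among all such configurations, one with the longest chain is taken; its number `ℓ` of edges is odd.

No interchange may now add a spoke or produce a longer chain, and one that keeps the spokes and
leaves `α` missing at `i` may not shorten this chain. This locates the spokes of the other colours
(`exit_right`, `exit_left`, `inner_beta`, `inner_alpha`): every colour has at least `(ℓ + 1) / 2`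
edges among the chain's arc and the spokes to it. Since a spoke copy at `i` is uncoloured, the total
multiplicity there exceeds `t * ((ℓ + 1) / 2)`, against the odd-set bound (`arc_violated`).

The argument breaks only if some colour is opposite to `α` on the whole complement of the chain.
Then the rim is even, `β` is a perfect matching of the rim, and the same count over the whole wheel
gives the contradiction (`rim_violated`). -/

set_option linter.unusedSectionVars false

/-! ### Rim arcs, two-coloured chains and Kempe interchanges. -/

section Kempe

variable {m : ℕ} [NeZero m]

theorem ZMod.add_natCast_inj (p : ZMod m) {a b : ℕ} (ha : a < m) (hb : b < m)
    (h : p + (a : ZMod m) = p + b) : a = b := by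
  have h1 : (a : ZMod m) = b := add_left_cancel h
  have h2 := congrArg ZMod.val h1
  rwa [ZMod.val_natCast_of_lt ha, ZMod.val_natCast_of_lt hb] at h2

theorem ZMod.exists_add_natCast (p e : ZMod m) : ∃ n < m, e = p + (n : ZMod m) :=
  ⟨(e - p).val, ZMod.val_lt _, by rw [ZMod.natCast_zmod_val]; ring⟩

theorem ZMod.add_natCast_pred (p : ZMod m) : p + ((m - 1 : ℕ) : ZMod m) = p - 1 := by
  have : 1 ≤ m := Nat.one_le_iff_ne_zero.2 (NeZero.ne m)
  rw [Nat.cast_sub this]; simp [sub_eq_add_neg]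

/-- The vertex `v` of the rim is on neither of the two rim edges `v - 1` and `v` of `y`. -/
def Uncovered (y : ZMod m → Bool) (v : ZMod m) : Prop := y (v - 1) = false ∧ y v = false

/-- No two consecutive rim edges are in `y`. -/
def IsRimMatching (y : ZMod m → Bool) : Prop := ∀ e, y e = true → y (e + 1) = false

theorem IsRimMatching.pred {y : ZMod m → Bool} (h : IsRimMatching y) {e : ZMod m}
    (he : y e = true) : y (e - 1) = false := by
  by_contra hc
  have := h (e - 1) (by simpa using hc)
  simp [he] at this

/-- The rim edges `p, …, p + L - 1`. -/
def rimArc (p : ZMod m) (L : ℕ) : Finset (ZMod m) := (Finset.range L).image fun n : ℕ => p + (n : ZMod m)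

theorem mem_rimArc {p e : ZMod m} {L : ℕ} : e ∈ rimArc p L ↔ ∃ n < L, e = p + (n : ZMod m) := by
  simp [rimArc, eq_comm]

theorem add_mem_rimArc_add_iff (p : ZMod m) {a b L : ℕ} (ha : a < m) (hL : b + L ≤ m) :
    p + (a : ZMod m) ∈ rimArc (p + (b : ZMod m)) L ↔ b ≤ a ∧ a < b + L := by
  rw [mem_rimArc]
  constructor
  · rintro ⟨n, hn, h⟩
    have := ZMod.add_natCast_inj p (a := a) (b := b + n) ha (by omega) (by push_cast; rw [h]; ring)
    omega
  · rintro ⟨h1, h2⟩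
    exact ⟨a - b, by omega, by rw [Nat.cast_sub h1]; ring⟩

/-- A maximal arc of rim edges on which `y` and `z` differ, not the whole rim. -/
structure RimChain (y z : ZMod m → Bool) (p : ZMod m) (L : ℕ) : Prop where
  pos : 0 < L
  lt : L < m
  ne : ∀ n < L, y (p + (n : ZMod m)) ≠ z (p + (n : ZMod m))
  left : y (p - 1) = z (p - 1)
  right : y (p + (L : ZMod m)) = z (p + (L : ZMod m))

theorem exists_chain_right {y z : ZMod m → Bool} {p : ZMod m} (h1 : y p ≠ z p)
    (h2 : y (p - 1) = z (p - 1)) : ∃ L, RimChain y z p L := by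
  classical
  have hm : 1 ≤ m := Nat.one_le_iff_ne_zero.2 (NeZero.ne m)
  have hex : ∃ L : ℕ, y (p + (L : ZMod m)) = z (p + (L : ZMod m)) :=
    ⟨m - 1, by rw [ZMod.add_natCast_pred]; exact h2⟩
  refine ⟨Nat.find hex, ?_, ?_, fun n hn => Nat.find_min hex hn, h2, Nat.find_spec hex⟩
  · rw [Nat.pos_iff_ne_zero]
    intro h0
    have := Nat.find_spec hex
    rw [h0] at this
    simp [h1] at this
  · have : Nat.find hex ≤ m - 1 := Nat.find_min' hex (by rw [ZMod.add_natCast_pred]; exact h2)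
    omega

theorem exists_chain_left {y z : ZMod m → Bool} {q : ZMod m} (h1 : y (q - 1) ≠ z (q - 1))
    (h2 : y q = z q) : ∃ p L, RimChain y z p L ∧ p + (L : ZMod m) = q := by
  classical
  have hm : 1 ≤ m := Nat.one_le_iff_ne_zero.2 (NeZero.ne m)
  have hlast : q - 1 - ((m - 1 : ℕ) : ZMod m) = q := by
    rw [Nat.cast_sub hm]; simp
  have hex : ∃ L : ℕ, y (q - 1 - (L : ZMod m)) = z (q - 1 - (L : ZMod m)) :=
    ⟨m - 1, by rw [hlast]; exact h2⟩
  have hlt : Nat.find hex ≤ m - 1 := Nat.find_min' hex (by rw [hlast]; exact h2)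
  refine ⟨q - (Nat.find hex : ℕ), Nat.find hex, ⟨?_, by omega, fun n hn => ?_, ?_, ?_⟩, by ring⟩
  · rw [Nat.pos_iff_ne_zero]
    intro h0
    have := Nat.find_spec hex
    rw [h0] at this
    simp [h1] at this
  · have := Nat.find_min hex (m := Nat.find hex - 1 - n) (by omega)
    have e : q - 1 - ((Nat.find hex - 1 - n : ℕ) : ZMod m) = q - (Nat.find hex : ℕ) + (n : ZMod m) := by
      rw [Nat.cast_sub (by omega), Nat.cast_sub (by omega)]; push_cast; ring
    rwa [e] at this
  · have := Nat.find_spec hex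
    have e : q - 1 - ((Nat.find hex : ℕ) : ZMod m) = q - (Nat.find hex : ℕ) - 1 := by ring
    rwa [e] at this
  · simpa using h2

theorem RimChain.length_eq {y z : ZMod m → Bool} {p : ZMod m} {L n : ℕ} (h : RimChain y z p L)
    (hn : y (p + (n : ZMod m)) = z (p + (n : ZMod m))) : L ≤ n := by
  by_contra hc
  exact h.ne n (by omega) hn

variable {κ : Type*} [DecidableEq κ]

/-- Interchange the colours `α` and `β` on the rim edges in `C`. -/
def kempe (x : κ → ZMod m → Bool) (α β : κ) (C : Finset (ZMod m)) : κ → ZMod m → Bool :=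
  fun c e => if e ∈ C then x (Equiv.swap α β c) e else x c e

theorem kempe_other {x : κ → ZMod m → Bool} {α β c : κ} {C : Finset (ZMod m)} (h1 : c ≠ α)
    (h2 : c ≠ β) : kempe x α β C c = x c := by
  funext e; simp [kempe, Equiv.swap_apply_of_ne_of_ne h1 h2]

theorem kempe_notMem {x : κ → ZMod m → Bool} {α β c : κ} {C : Finset (ZMod m)} {e : ZMod m}
    (h : e ∉ C) : kempe x α β C c e = x c e := by
  simp [kempe, h]

theorem kempe_left_mem {x : κ → ZMod m → Bool} {α β : κ} {C : Finset (ZMod m)} {e : ZMod m}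
    (h : e ∈ C) : kempe x α β C α e = x β e := by
  simp [kempe, h]

theorem kempe_right_mem {x : κ → ZMod m → Bool} {α β : κ} {C : Finset (ZMod m)} {e : ZMod m}
    (h : e ∈ C) : kempe x α β C β e = x α e := by
  simp [kempe, h]

theorem kempe_card [Fintype κ] (x : κ → ZMod m → Bool) (α β : κ) (C : Finset (ZMod m)) (e : ZMod m) :
    (Finset.univ.filter fun c => kempe x α β C c e = true).card =
      (Finset.univ.filter fun c => x c e = true).card := by
  by_cases h : e ∈ C
  · simp only [kempe, h, if_true]
    refine Finset.card_bij (fun c _ => Equiv.swap α β c) ?_ ?_ ?_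
    · simp
    · intro a _ b _ hab; simpa using hab
    · intro b hb
      exact ⟨Equiv.swap α β b, by simpa using hb, by simp⟩
  · simp [kempe, h]

theorem swap_apply_eq_of_eq {x : κ → ZMod m → Bool} {α β : κ} {e : ZMod m} (h : x α e = x β e)
    (c : κ) : x (Equiv.swap α β c) e = x c e := by
  rcases eq_or_ne c α with rfl | h1
  · simp [h]
  rcases eq_or_ne c β with rfl | h2
  · simp [h]
  · rw [Equiv.swap_apply_of_ne_of_ne h1 h2]

theorem rimArc_step {p e : ZMod m} {L : ℕ} (h1 : e ∈ rimArc p L) (h2 : e + 1 ∉ rimArc p L) :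
    e + 1 = p + (L : ZMod m) := by
  rw [mem_rimArc] at h1 h2
  obtain ⟨n, hn, rfl⟩ := h1
  push Not at h2
  by_cases h : n + 1 < L
  · exact absurd (by push_cast; ring) (h2 (n + 1) h)
  · have : L = n + 1 := by omega
    subst this; push_cast; ring

theorem rimArc_step' {p e : ZMod m} {L : ℕ} (h1 : e - 1 ∉ rimArc p L) (h2 : e ∈ rimArc p L) :
    e = p := by
  rw [mem_rimArc] at h1 h2
  obtain ⟨n, hn, rfl⟩ := h2
  push Not at h1
  rcases n with _ | n
  · simp
  · exact absurd (by push_cast; ring) (h1 n (by omega))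

section
variable {x : κ → ZMod m → Bool} {α β : κ} {p : ZMod m} {L : ℕ}

/-- On the edges adjoining the two ends of the chain, `α` and `β` agree, so it is immaterial whether
the swap is applied there. -/
theorem kempe_matching (hx : ∀ c, IsRimMatching (x c)) (h : RimChain (x α) (x β) p L) (c : κ) :
    IsRimMatching (kempe x α β (rimArc p L) c) := by
  intro e he
  by_cases h1 : e ∈ rimArc p L <;> by_cases h2 : e + 1 ∈ rimArc p L
  · simp only [kempe, h1, h2, if_true] at he ⊢
    exact hx _ _ he
  · have := rimArc_step h1 h2
    simp only [kempe, h1, h2, if_true, if_false] at he ⊢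
    rw [← swap_apply_eq_of_eq (x := x) (α := α) (β := β) (by rw [this]; exact h.right)]
    exact hx _ _ he
  · have := rimArc_step' (e := e + 1) (by simpa using h1) h2
    have h3 : e = p - 1 := by rw [← this]; ring
    simp only [kempe, h1, h2, if_true, if_false] at he ⊢
    apply hx
    rwa [swap_apply_eq_of_eq (x := x) (α := α) (β := β) (by rw [h3]; exact h.left)]
  · simp only [kempe, h1, h2, if_false] at he ⊢
    exact hx _ _ he

/-- At an inner vertex of the chain each of the two colours owns exactly one of the two edges, so
both cover the vertex before and after. At an end they trade roles instead, as the next lemmas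
record. -/
theorem kempe_uncovered (hx : ∀ c, IsRimMatching (x c)) (h : RimChain (x α) (x β) p L) (c : κ)
    {v : ZMod m} (h1 : v ≠ p) (h2 : v ≠ p + (L : ZMod m)) :
    Uncovered (kempe x α β (rimArc p L) c) v ↔ Uncovered (x c) v := by
  by_cases h3 : v - 1 ∈ rimArc p L <;> by_cases h4 : v ∈ rimArc p L
  · have key : ∀ n ∈ rimArc p L, x α n ≠ x β n := by
      intro n hn
      obtain ⟨k, hk, rfl⟩ := mem_rimArc.1 hn
      exact h.ne k hk
    have k1 := key _ h3
    have k2 := key _ h4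
    have a1 := hx α (v - 1)
    have a2 := hx β (v - 1)
    rw [sub_add_cancel] at a1 a2
    simp only [Uncovered, kempe, h3, h4, if_true]
    rcases eq_or_ne c α with rfl | hc
    · simp only [Equiv.swap_apply_left]; grind
    rcases eq_or_ne c β with rfl | hc'
    · simp only [Equiv.swap_apply_right]; grind
    rw [Equiv.swap_apply_of_ne_of_ne hc hc']
  · exact absurd (by simpa using rimArc_step h3 (by simpa using h4)) h2
  · exact absurd (rimArc_step' h3 h4) h1
  · simp [Uncovered, kempe, h3, h4]

theorem RimChain.pred_notMem (h : RimChain (x α) (x β) p L) : p - 1 ∉ rimArc p L := by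
  intro hm
  obtain ⟨k, hk, h'⟩ := mem_rimArc.1 hm
  exact h.ne k hk (by rw [← h']; exact h.left)

theorem RimChain.end_notMem (h : RimChain (x α) (x β) p L) : p + (L : ZMod m) ∉ rimArc p L := by
  intro hm
  obtain ⟨k, hk, h'⟩ := mem_rimArc.1 hm
  exact h.ne k hk (by rw [← h']; exact h.right)

theorem kempe_uncovered_left (h : RimChain (x α) (x β) p L) (c : κ) :
    Uncovered (kempe x α β (rimArc p L) c) p ↔ Uncovered (x (Equiv.swap α β c)) p := by
  have h1 : p ∈ rimArc p L := mem_rimArc.2 ⟨0, h.pos, by simp⟩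
  simp only [Uncovered, kempe, h1, h.pred_notMem, if_true, if_false]
  rw [swap_apply_eq_of_eq h.left]

theorem kempe_uncovered_right (h : RimChain (x α) (x β) p L) (c : κ) :
    Uncovered (kempe x α β (rimArc p L) c) (p + (L : ZMod m)) ↔
      Uncovered (x (Equiv.swap α β c)) (p + (L : ZMod m)) := by
  have h1 : p + (L : ZMod m) - 1 ∈ rimArc p L :=
    mem_rimArc.2 ⟨L - 1, by have := h.pos; omega, by rw [Nat.cast_sub h.pos]; push_cast; ring⟩
  simp only [Uncovered, kempe, h1, h.end_notMem, if_true, if_false]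
  rw [swap_apply_eq_of_eq h.right]

end

end Kempe

/-! ### Bookkeeping for the assignment of spokes to colours. -/

section Spokes

variable {ι : Type*} [DecidableEq ι] {κ : Type*} [Fintype κ] [DecidableEq κ]

/-- The number of colours whose spoke ends at `v`. -/
def spokeCount (σ : κ → Option ι) (v : ι) : ℕ :=
  (Finset.univ.filter fun c => σ c = some v).card

/-- The number of colours that have a spoke. -/
def spoked (σ : κ → Option ι) : ℕ := (Finset.univ.filter fun c => σ c ≠ none).card

theorem spokeCount_update_self {σ : κ → Option ι} {c : κ} {v : ι} (h : σ c ≠ some v) :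
    spokeCount (Function.update σ c (some v)) v = spokeCount σ v + 1 := by
  unfold spokeCount
  have : (Finset.univ.filter fun d => Function.update σ c (some v) d = some v) =
      insert c (Finset.univ.filter fun d => σ d = some v) := by
    ext d
    rcases eq_or_ne d c with rfl | hd
    · simp
    · simp [hd]
  rw [this, Finset.card_insert_of_notMem (by simpa using h)]

theorem spokeCount_update_old {σ : κ → Option ι} {c : κ} {v k : ι} (h : σ c = some k)
    (hk : k ≠ v) : spokeCount (Function.update σ c (some v)) k + 1 = spokeCount σ k := by
  unfold spokeCount
  have : (Finset.univ.filter fun d => Function.update σ c (some v) d = some k) =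
      (Finset.univ.filter fun d => σ d = some k).erase c := by
    ext d
    rcases eq_or_ne d c with rfl | hd
    · simp [hk.symm]
    · simp [hd]
  rw [this, Finset.card_erase_add_one (by simpa using h)]

theorem spokeCount_update_le {σ : κ → Option ι} {c : κ} {v u : ι} (hu : u ≠ v) :
    spokeCount (Function.update σ c (some v)) u ≤ spokeCount σ u := by
  unfold spokeCount
  refine Finset.card_le_card fun d hd => ?_
  rcases eq_or_ne d c with rfl | hdc
  · simp [hu.symm] at hd
  · simpa [Function.update_of_ne hdc] using hd

theorem spoked_update_none {σ : κ → Option ι} {c : κ} {v : ι} (h : σ c = none) :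
    spoked (Function.update σ c (some v)) = spoked σ + 1 := by
  unfold spoked
  have : (Finset.univ.filter fun d => Function.update σ c (some v) d ≠ none) =
      insert c (Finset.univ.filter fun d => σ d ≠ none) := by
    ext d
    rcases eq_or_ne d c with rfl | hd
    · simp
    · simp [hd]
  rw [this, Finset.card_insert_of_notMem (by simpa using h)]

theorem spoked_update_some {σ : κ → Option ι} {c : κ} {v k : ι} (h : σ c = some k) :
    spoked (Function.update σ c (some v)) = spoked σ := by
  unfold spoked
  congr 1
  ext d
  rcases eq_or_ne d c with rfl | hd
  · simp [h]
  · simp [Function.update_of_ne hd]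

/-- At most `s v` colours have their spoke at `v`. -/
def SpokeBound (s : ι → ℕ) (σ : κ → Option ι) : Prop := ∀ v, spokeCount σ v ≤ s v

/-- Fewer than `s v` colours have their spoke at `v`. -/
def Unsaturated (s : ι → ℕ) (σ : κ → Option ι) (v : ι) : Prop := spokeCount σ v < s v

theorem SpokeBound.update {s : ι → ℕ} {σ : κ → Option ι} {c : κ} {v : ι} (h : SpokeBound s σ)
    (hv : Unsaturated s σ v) : SpokeBound s (Function.update σ c (some v)) := by
  intro u
  rcases eq_or_ne u v with rfl | hu
  · by_cases hc : σ c = some u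
    · rw [← hc, Function.update_eq_self]; exact h u
    · rw [spokeCount_update_self hc]; exact hv
  · exact (spokeCount_update_le hu).trans (h u)

theorem SpokeBound.unsaturated_update {s : ι → ℕ} {σ : κ → Option ι} {c : κ} {v k : ι}
    (h : SpokeBound s σ) (hc : σ c = some k) (hk : k ≠ v) :
    Unsaturated s (Function.update σ c (some v)) k := by
  have := spokeCount_update_old hc hk
  have := h k
  unfold Unsaturated; omega

end Spokes

/-! ### Partial colourings with a maximal number of coloured spokes. -/

section Colouring

variable {m : ℕ} [NeZero m] {κ : Type*} [Fintype κ] [DecidableEq κ]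

/-- A proper edge colouring of all rim edges (with multiplicities `r`) and of some of the spokes
(with multiplicities `s`) of a wheel: `x c` is the set of rim edges of colour `c`, and `σ c` is the
end of the spoke of colour `c`. -/
structure IsColouring (r s : ZMod m → ℕ) (x : κ → ZMod m → Bool) (σ : κ → Option (ZMod m)) :
    Prop where
  matching : ∀ c, IsRimMatching (x c)
  rim : ∀ e, (Finset.univ.filter fun c => x c e = true).card = r e
  free : ∀ c v, σ c = some v → Uncovered (x c) v
  bound : SpokeBound s σ

/-- No colouring has more than `N` coloured spokes. -/
def IsSpokeMax (κ : Type*) [Fintype κ] [DecidableEq κ] (r s : ZMod m → ℕ) (N : ℕ) : Prop :=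
  ∀ (x : κ → ZMod m → Bool) (σ : κ → Option (ZMod m)), IsColouring r s x σ → spoked σ ≤ N

variable {r s : ZMod m → ℕ} {N : ℕ} {x : κ → ZMod m → Bool} {σ : κ → Option (ZMod m)}

theorem IsColouring.kempe (h : IsColouring r s x σ) {α β : κ} {p : ZMod m} {L : ℕ}
    (hc : RimChain (x α) (x β) p L) {σ' : κ → Option (ZMod m)}
    (hfree : ∀ c v, σ' c = some v → Uncovered (kempe x α β (rimArc p L) c) v)
    (hb : SpokeBound s σ') : IsColouring r s (kempe x α β (rimArc p L)) σ' :=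
  ⟨kempe_matching h.matching hc, fun e => by rw [kempe_card, h.rim], hfree, hb⟩

/-- A Kempe interchange on a chain that meets neither spoke keeps the spokes free. -/
theorem IsColouring.kempe_same (h : IsColouring r s x σ) {α β : κ} {p : ZMod m} {L : ℕ}
    (hc : RimChain (x α) (x β) p L)
    (h1 : ∀ v, σ α = some v → v ≠ p ∧ v ≠ p + (L : ZMod m))
    (h2 : ∀ v, σ β = some v → v ≠ p ∧ v ≠ p + (L : ZMod m)) :
    IsColouring r s (_root_.kempe x α β (rimArc p L)) σ := by
  refine h.kempe hc (fun c v hv => ?_) h.bound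
  rcases eq_or_ne c α with rfl | ha
  · rw [kempe_uncovered h.matching hc _ (h1 v hv).1 (h1 v hv).2]; exact h.free _ _ hv
  rcases eq_or_ne c β with rfl | hb
  · rw [kempe_uncovered h.matching hc _ (h2 v hv).1 (h2 v hv).2]; exact h.free _ _ hv
  rw [kempe_other ha hb]; exact h.free _ _ hv

/-- Recolour: give `c` the spoke `v`. -/
theorem IsColouring.update (h : IsColouring r s x σ) {c : κ} {v : ZMod m}
    (hu : Unsaturated s σ v) (hc : Uncovered (x c) v) :
    IsColouring r s x (Function.update σ c (some v)) := by
  refine ⟨h.matching, h.rim, fun d w hd => ?_, h.bound.update hu⟩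
  rcases eq_or_ne d c with rfl | hdc
  · simp at hd; exact hd ▸ hc
  · rw [Function.update_of_ne hdc] at hd; exact h.free _ _ hd

theorem IsColouring.not_uncovered (h : IsColouring r s x σ) (hmax : IsSpokeMax κ r s N)
    (hN : spoked σ = N) {i : ZMod m} (hi : Unsaturated s σ i) {β : κ} (hβ : σ β = none) :
    ¬ Uncovered (x β) i := by
  intro hu
  have := hmax x _ (h.update hi hu)
  rw [spoked_update_none hβ] at this
  omega

theorem RimChain.uncovered_left (hx : ∀ c, IsRimMatching (x c)) {α β : κ} {p : ZMod m} {L : ℕ}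
    (h : RimChain (x α) (x β) p L) :
    (Uncovered (x α) p ∧ ¬ Uncovered (x β) p) ∨ (¬ Uncovered (x α) p ∧ Uncovered (x β) p) := by
  have h1 := h.ne 0 h.pos
  have h2 := h.left
  have a1 := hx α (p - 1)
  have a2 := hx β (p - 1)
  simp only [sub_add_cancel, Nat.cast_zero, add_zero] at a1 a2 h1
  unfold Uncovered
  grind

/-- If the spoke `i` lacks a colour, `β` is missing at the centre and `α` is missing at `i`, then
the chain of `α` and `β` that starts at `i` ends at the spoke of colour `α`. -/
theorem IsColouring.chain_end (h : IsColouring r s x σ) (hmax : IsSpokeMax κ r s N)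
    (hN : spoked σ = N) {i : ZMod m} (hi : Unsaturated s σ i) {α β : κ} (hβ : σ β = none)
    (hα : Uncovered (x α) i) {j : ZMod m} (hj : σ α = some j)
    {p : ZMod m} {L : ℕ} (hc : RimChain (x α) (x β) p L)
    (hip : i = p ∨ i = p + (L : ZMod m)) : j = p ∨ j = p + (L : ZMod m) := by
  by_contra hcon
  push Not at hcon
  have hab : α ≠ β := by rintro rfl; simp [hβ] at hj
  have h' := h.kempe_same hc (fun v hv => by rw [hj] at hv; cases hv; exact hcon)
    (fun v hv => by simp [hβ] at hv)
  -- The interchange would disturb no spoke and make `β` missing both at `i` and at the centre, so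
  -- one more spoke could be coloured.
  refine h'.not_uncovered hmax hN hi hβ ?_
  rcases hip with rfl | rfl
  · rw [kempe_uncovered_left hc, Equiv.swap_apply_right]; exact hα
  · rw [kempe_uncovered_right hc, Equiv.swap_apply_right]; exact hα

end Colouring

/-! ### The longest alternating chain, and colours that continue past its ends. -/

section Alternating

variable {m : ℕ} [NeZero m] {κ : Type*} [Fintype κ] [DecidableEq κ]

/-- A colouring with the maximal number `N` of coloured spokes, a spoke at `i` without a colour, a
colour `β` missing at the centre and a colour `α` missing at `i` whose spoke is at `i + ℓ`, such
that the chain of `α` and `β` from `i` to `i + ℓ` consists of the edges `i, …, i + ℓ - 1`. -/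
structure IsAlternating (r s : ZMod m → ℕ) (N : ℕ) (x : κ → ZMod m → Bool)
    (σ : κ → Option (ZMod m)) (i : ZMod m) (α β : κ) (ℓ : ℕ) : Prop where
  col : IsColouring r s x σ
  card : spoked σ = N
  unsat : Unsaturated s σ i
  spoke : σ α = some (i + (ℓ : ZMod m))
  missing : σ β = none
  unc : Uncovered (x α) i
  chain : RimChain (x α) (x β) i ℓ

/-- No alternating chain between spokes has more than `ℓ` edges. -/
def IsLongest (κ : Type*) [Fintype κ] [DecidableEq κ] (r s : ZMod m → ℕ) (N ℓ : ℕ) : Prop :=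
  ∀ (x : κ → ZMod m → Bool) (σ : κ → Option (ZMod m)) (i : ZMod m) (α β : κ) (ℓ' : ℕ),
    IsAlternating r s N x σ i α β ℓ' → ℓ' ≤ ℓ

variable {r s : ZMod m → ℕ} {N : ℕ} {x : κ → ZMod m → Bool} {σ : κ → Option (ZMod m)}
  {i : ZMod m} {α β c : κ} {ℓ : ℕ}

/-- The orientation built into `IsAlternating` costs nothing: if the unsaturated vertex `v` is the
right end of the chain, moving the spoke of `α` from `w` to `v` makes the left end `w` unsaturated,
with the same rim colouring and the same number of spokes. -/
theorem IsColouring.exists_alternating (h : IsColouring r s x σ) (hmax : IsSpokeMax κ r s N)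
    (hN : spoked σ = N) {v : ZMod m} (hv : Unsaturated s σ v) (hβ : σ β = none)
    (hα : Uncovered (x α) v) {w : ZMod m} (hw : σ α = some w) (hwv : w ≠ v)
    {p : ZMod m} {L : ℕ} (hc : RimChain (x α) (x β) p L) (hvp : v = p ∨ v = p + (L : ZMod m)) :
    (∃ σ', IsAlternating r s N x σ' p α β L) ∧
      ((v = p ∧ w = p + (L : ZMod m)) ∨ (v = p + (L : ZMod m) ∧ w = p)) := by
  have hab : β ≠ α := by rintro rfl; simp [hβ] at hw
  have he := h.chain_end hmax hN hv hβ hα hw hc hvp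
  rcases hvp with rfl | rfl
  · obtain rfl := he.resolve_left hwv
    exact ⟨⟨σ, h, hN, hv, hw, hβ, hα, hc⟩, Or.inl ⟨rfl, rfl⟩⟩
  · obtain rfl := he.resolve_right hwv
    refine ⟨⟨_, h.update hv hα, ?_, h.bound.unsaturated_update hw hwv, by simp, ?_,
      h.free _ _ hw, hc⟩, Or.inr ⟨rfl, rfl⟩⟩
    · rw [spoked_update_some hw, hN]
    · rw [Function.update_of_ne hab, hβ]

theorem IsColouring.chain_le (h : IsColouring r s x σ) (hmax : IsSpokeMax κ r s N)
    (hlong : IsLongest κ r s N ℓ)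
    (hN : spoked σ = N) {v : ZMod m} (hv : Unsaturated s σ v) (hβ : σ β = none)
    (hα : Uncovered (x α) v) {w : ZMod m} (hw : σ α = some w) (hwv : w ≠ v)
    {p : ZMod m} {L : ℕ} (hc : RimChain (x α) (x β) p L) (hvp : v = p ∨ v = p + (L : ZMod m)) :
    L ≤ ℓ ∧ ((v = p ∧ w = p + (L : ZMod m)) ∨ (v = p + (L : ZMod m) ∧ w = p)) := by
  obtain ⟨⟨σ', hσ'⟩, h2⟩ := h.exists_alternating hmax hN hv hβ hα hw hwv hc hvp
  exact ⟨hlong _ _ _ _ _ _ hσ', h2⟩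

namespace IsAlternating

theorem ne (h : IsAlternating r s N x σ i α β ℓ) : α ≠ β := by
  rintro rfl; have := h.spoke; simp [h.missing] at this

theorem lt (h : IsAlternating r s N x σ i α β ℓ) : ℓ < m := h.chain.lt

theorem unc_end (h : IsAlternating r s N x σ i α β ℓ) : Uncovered (x α) (i + (ℓ : ZMod m)) :=
  h.col.free _ _ h.spoke

theorem end_sub_one (h : IsAlternating r s N x σ i α β ℓ) :
    i + (ℓ : ZMod m) - 1 = i + ((ℓ - 1 : ℕ) : ZMod m) := by
  rw [Nat.cast_sub h.chain.pos]; push_cast; ring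

theorem vals (h : IsAlternating r s N x σ i α β ℓ) {n : ℕ} (hn : n < ℓ) :
    x α (i + (n : ZMod m)) = decide (n % 2 = 1) ∧ x β (i + (n : ZMod m)) = decide (n % 2 = 0) := by
  induction n with
  | zero =>
    have := h.chain.ne 0 hn
    have := h.unc.2
    simp at *
    grind
  | succ n ih =>
    obtain ⟨h1, h2⟩ := ih (by omega)
    have h3 := h.chain.ne (n + 1) hn
    have a1 := h.col.matching α (i + (n : ZMod m))
    have a2 := h.col.matching β (i + (n : ZMod m))
    have e : i + ((n + 1 : ℕ) : ZMod m) = i + (n : ZMod m) + 1 := by push_cast; ring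
    rw [e] at h3 ⊢
    rcases Nat.mod_two_eq_zero_or_one n with h0 | h0
    · have : (n + 1) % 2 = 1 := by omega
      simp only [h0, this] at *
      simp at *
      grind
    · have : (n + 1) % 2 = 0 := by omega
      simp only [h0, this] at *
      simp at *
      grind

/-- `α` is missing at both ends of the chain, so the first and the last edge both have colour `β`.
-/
theorem odd (h : IsAlternating r s N x σ i α β ℓ) : ℓ % 2 = 1 := by
  have h0 := h.chain.pos
  have h1 := h.unc_end.1
  rw [h.end_sub_one, (h.vals (n := ℓ - 1) (by omega)).1] at h1
  simp at h1
  omega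

theorem beta_end_pred (h : IsAlternating r s N x σ i α β ℓ) : x β (i + (ℓ : ZMod m) - 1) = true := by
  have h0 := h.chain.pos
  have := h.odd
  rw [h.end_sub_one, (h.vals (n := ℓ - 1) (by omega)).2]
  simp; omega

theorem beta_end (h : IsAlternating r s N x σ i α β ℓ) : x β (i + (ℓ : ZMod m)) = false := by
  simpa using h.col.matching β _ h.beta_end_pred

theorem beta_start (h : IsAlternating r s N x σ i α β ℓ) : x β i = true := by
  simpa using (h.vals h.chain.pos).2

theorem beta_pred (h : IsAlternating r s N x σ i α β ℓ) : x β (i - 1) = false :=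
  (h.col.matching β).pred h.beta_start

theorem end_ne (h : IsAlternating r s N x σ i α β ℓ) : i + (ℓ : ZMod m) ≠ i := by
  intro h'
  have := ZMod.add_natCast_inj i (a := ℓ) (b := 0) h.lt (by have := h.lt; omega) (by simpa using h')
  have := h.chain.pos
  omega

/-- The colour `c` differs from `α` on all edges outside the chain. -/
def Crossing (x : κ → ZMod m → Bool) (i : ZMod m) (α : κ) (ℓ : ℕ) (c : κ) : Prop :=
  ∀ n, ℓ ≤ n → n < m → x c (i + (n : ZMod m)) ≠ x α (i + (n : ZMod m))

/-- The `α`-`c` chain starting at the right end `j` of the long chain stops before reaching `i`,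
because `c` is not crossing. Interchanging it makes `c` missing at `j`, and moving the spoke of `α`
to `i` makes `j` unsaturated. Maximality and the choice of the longest chain then leave one possible
kind of position for the spoke of `c`. -/
theorem exit_right (h : IsAlternating r s N x σ i α β ℓ) (hmax : IsSpokeMax κ r s N)
    (hlong : IsLongest κ r s N ℓ) (hcα : c ≠ α) (hcβ : c ≠ β)
    (hx : x c (i + (ℓ : ZMod m)) = true) (hn : ¬ Crossing x i α ℓ c) :
    ∃ a < ℓ, σ c = some (i + (a : ZMod m)) ∧
      ∀ n, a ≤ n → n < ℓ → x c (i + (n : ZMod m)) ≠ x β (i + (n : ZMod m)) := by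
  obtain ⟨n, hn1, hn2, hn3⟩ : ∃ n, ℓ ≤ n ∧ n < m ∧ x c (i + (n : ZMod m)) = x α (i + (n : ZMod m)) := by
    simpa [Crossing] using hn
  obtain ⟨L, hL⟩ := exists_chain_right (y := x α) (z := x c) (p := i + (ℓ : ZMod m))
    (by rw [hx, h.unc_end.2]; simp)
    (by rw [(h.col.matching c).pred hx, h.unc_end.1])
  have hLn : L ≤ n - ℓ := hL.length_eq (by rw [Nat.cast_sub hn1]; ring_nf; exact hn3.symm)
  have hLpos := hL.pos
  have hpos := h.chain.pos
  have hlast : i + (ℓ : ZMod m) + (L : ZMod m) = i + ((ℓ + L : ℕ) : ZMod m) := by push_cast; ring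
  have hij : i ≠ i + (ℓ : ZMod m) := h.end_ne.symm
  have hiy : i ≠ i + (ℓ : ZMod m) + (L : ZMod m) := by
    rw [hlast]; intro h'
    have := ZMod.add_natCast_inj i (a := 0) (b := ℓ + L) (by omega) (by omega) (by simpa using h')
    omega
  have hjy : i + (ℓ : ZMod m) + (L : ZMod m) ≠ i + (ℓ : ZMod m) := by
    rw [hlast]; intro h'
    have := ZMod.add_natCast_inj i (a := ℓ + L) (b := ℓ) (by omega) (by omega) h'
    omega
  set x' := kempe x α c (rimArc (i + (ℓ : ZMod m)) L) with hx'
  have hin : ∀ n < ℓ, ∀ d, x' d (i + (n : ZMod m)) = x d (i + (n : ZMod m)) := fun n hn d =>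
    kempe_notMem (by rw [add_mem_rimArc_add_iff i (by omega) (by omega)]; omega)
  have uαi : Uncovered (x' α) i := by
    rw [hx', kempe_uncovered h.col.matching hL _ hij hiy]; exact h.unc
  have ucj : Uncovered (x' c) (i + (ℓ : ZMod m)) := by
    rw [hx', kempe_uncovered_left hL, Equiv.swap_apply_right]; exact h.unc_end
  have uother : ∀ d, d ≠ α → d ≠ c → x' d = x d := fun d h1 h2 => kempe_other h1 h2
  have hb1 := h.col.bound.update (c := α) h.unsat
  have hu1 : Unsaturated s (Function.update σ α (some i)) (i + (ℓ : ZMod m)) :=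
    h.col.bound.unsaturated_update h.spoke hij.symm
  have hc1 : Function.update σ α (some i) c = σ c := Function.update_of_ne hcα _ _
  have hβ1 : Function.update σ α (some i) β = none := by
    rw [Function.update_of_ne h.ne.symm, h.missing]
  have hN1 : spoked (Function.update σ α (some i)) = N := by rw [spoked_update_some h.spoke, h.card]
  rcases hσ : σ c with _ | k
  · exfalso
    -- If `c` has no spoke, it can take the spoke at `j`, which raises the number of coloured
    -- spokes.
    have := hmax x' (Function.update (Function.update σ α (some i)) c (some (i + (ℓ : ZMod m))))
      (h.col.kempe hL (fun d v hd => ?_) (hb1.update hu1))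
    · rw [spoked_update_none (by rw [hc1, hσ]), hN1] at this
      omega
    · rcases eq_or_ne d c with rfl | hdc
      · simp at hd; exact hd ▸ ucj
      rw [Function.update_of_ne hdc] at hd
      rcases eq_or_ne d α with rfl | hdα
      · simp at hd; exact hd ▸ uαi
      rw [Function.update_of_ne hdα] at hd
      rw [kempe_other hdα hdc]
      exact h.col.free _ _ hd
  have hk : Uncovered (x c) k := h.col.free _ _ hσ
  have hkj : k ≠ i + (ℓ : ZMod m) := by rintro rfl; simp [hk.2] at hx
  -- If the spoke of `c` sits at the far end of the interchanged chain, `c` takes the spoke at `j`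
  -- and `α` the one at `k`. Then `i` is unsaturated again and the `α`-`β` chain from `i` runs past
  -- `j`, where `α` has gained an edge: it is too long.
  by_cases hky : k = i + (ℓ : ZMod m) + (L : ZMod m)
  · exfalso
    have hki : k ≠ i := by rw [hky]; exact hiy.symm
    have hc2 := spoked_update_some (v := i + (ℓ : ZMod m)) (hc1.trans hσ)
    have hb2 := hb1.update (c := c) hu1
    have hu2 := hb1.unsaturated_update (hc1.trans hσ) hkj
    have hα2 : Function.update (Function.update σ α (some i)) c (some (i + (ℓ : ZMod m))) α = some i := by
      rw [Function.update_of_ne hcα.symm]; simp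
    have hu3 := hb2.unsaturated_update (v := k) hα2 hki.symm
    have hb3 := hb2.update (c := α) hu2
    have uαk : Uncovered (x' α) k := by
      rw [hx', hky, kempe_uncovered_right hL, Equiv.swap_apply_left, ← hky]; exact hk
    set σ3 := Function.update
      (Function.update (Function.update σ α (some i)) c (some (i + (ℓ : ZMod m)))) α (some k) with hσ3
    have hcol : IsColouring r s x' σ3 := h.col.kempe hL (fun d v hd => by
      rcases eq_or_ne d α with rfl | hdα
      · simp [hσ3] at hd; exact hd ▸ uαk
      rw [hσ3, Function.update_of_ne hdα] at hd
      rcases eq_or_ne d c with rfl | hdc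
      · simp at hd; exact hd ▸ ucj
      rw [Function.update_of_ne hdc, Function.update_of_ne hdα] at hd
      rw [kempe_other hdα hdc]
      exact h.col.free _ _ hd) hb3
    have hcard : spoked σ3 = N := by rw [hσ3, spoked_update_some hα2, hc2, hN1]
    have hβ3 : σ3 β = none := by
      rw [hσ3, Function.update_of_ne h.ne.symm, Function.update_of_ne hcβ.symm, hβ1]
    have hβx : x' β = x β := uother β h.ne.symm hcβ.symm
    obtain ⟨L2, hL2⟩ := exists_chain_right (y := x' α) (z := x' β) (p := i)
      (by rw [hβx, h.beta_start, uαi.2]; simp) (by rw [hβx, h.beta_pred, uαi.1])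
    have hle := (hcol.chain_le hmax hlong hcard hu3 hβ3 uαi (by simp [hσ3]) hki hL2
      (Or.inl rfl)).1
    have hr := hL2.right
    rcases hle.lt_or_eq with hlt | rfl
    · rw [hin _ hlt, hin _ hlt] at hr
      exact h.chain.ne _ hlt hr
    · rw [hβx, h.beta_end, hx', kempe_left_mem, hx] at hr
      · simp at hr
      · exact mem_rimArc.2 ⟨0, hLpos, by simp⟩
  · have hcol : IsColouring r s x' (Function.update σ α (some i)) := h.col.kempe hL (fun d v hd => by
      rcases eq_or_ne d α with rfl | hdα
      · simp at hd; exact hd ▸ uαi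
      rw [Function.update_of_ne hdα] at hd
      rcases eq_or_ne d c with rfl | hdc
      · rw [hσ] at hd; cases hd
        rw [kempe_uncovered h.col.matching hL _ hkj hky]; exact hk
      rw [kempe_other hdα hdc]
      exact h.col.free _ _ hd) hb1
    have hβx : x' β = x β := uother β h.ne.symm hcβ.symm
    -- Otherwise `j` is an unsaturated vertex at which `c` is missing, so the `c`-`β` chain ending
    -- at `j` leads to the spoke of `c`. Its length is at most `ℓ`, so it lies in the arc, where the
    -- interchange changed nothing.
    obtain ⟨p, L2, hL2, hp⟩ := exists_chain_left (y := x' c) (z := x' β) (q := i + (ℓ : ZMod m))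
      (by rw [hβx, h.beta_end_pred, ucj.1]; simp) (by rw [hβx, h.beta_end, ucj.2])
    obtain ⟨hle, hends⟩ := hcol.chain_le hmax hlong hN1 hu1 hβ1 ucj (hc1.trans hσ) hkj hL2
      (Or.inr hp.symm)
    have hkp : k = p := by
      rcases hends with ⟨_, h2⟩ | ⟨_, h2⟩
      · exact absurd (h2.trans hp) hkj
      · exact h2
    have hpa : p = i + ((ℓ - L2 : ℕ) : ZMod m) := by
      rw [Nat.cast_sub hle, eq_sub_of_add_eq hp]; ring
    refine ⟨ℓ - L2, by have := hL2.pos; omega, by rw [hkp, hpa], fun n h1 h2 => ?_⟩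
    have := hL2.ne (n - (ℓ - L2)) (by omega)
    rw [hpa, add_assoc, ← Nat.cast_add, Nat.add_sub_cancel' h1, hin n h2, hin n h2] at this
    exact this

/-- The mirror image of `exit_right`. Here `i` is already unsaturated, so the spoke of `α` need not
be moved at the outset. -/
theorem exit_left (h : IsAlternating r s N x σ i α β ℓ) (hmax : IsSpokeMax κ r s N)
    (hlong : IsLongest κ r s N ℓ) (hcα : c ≠ α) (hcβ : c ≠ β)
    (hx : x c (i - 1) = true) (hn : ¬ Crossing x i α ℓ c) :
    ∃ b, 0 < b ∧ b ≤ ℓ ∧ σ c = some (i + (b : ZMod m)) ∧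
      ∀ n < b, x c (i + (n : ZMod m)) ≠ x β (i + (n : ZMod m)) := by
  obtain ⟨n, hn1, hn2, hn3⟩ : ∃ n, ℓ ≤ n ∧ n < m ∧ x c (i + (n : ZMod m)) = x α (i + (n : ZMod m)) := by
    simpa [Crossing] using hn
  have hxi : x c i = false := by simpa using h.col.matching c _ hx
  obtain ⟨p, L, hL, hp⟩ := exists_chain_left (y := x α) (z := x c) (q := i)
    (by rw [hx, h.unc.1]; simp) (by rw [hxi, h.unc.2])
  have hLpos := hL.pos
  have hLlt := hL.lt
  have hpos := h.chain.pos
  have hlt := h.lt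
  have hpe : p = i + ((m - L : ℕ) : ZMod m) := by
    rw [Nat.cast_sub hLlt.le, eq_sub_of_add_eq hp]; simp; ring
  have hLn : n + L < m := by
    by_contra hcon
    refine hL.ne (n - (m - L)) (by omega) ?_
    rw [hpe, add_assoc, ← Nat.cast_add, Nat.add_sub_cancel' (by omega), hn3]
  have hip : i ≠ p := by
    intro h'; rw [← h'] at hpe
    have := ZMod.add_natCast_inj i (a := 0) (b := m - L) (by omega) (by omega) (by simpa using hpe)
    omega
  have hjp : i + (ℓ : ZMod m) ≠ p := by
    rw [hpe]; intro h'
    have := ZMod.add_natCast_inj i (a := ℓ) (b := m - L) (by omega) (by omega) h'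
    omega
  set x' := kempe x α c (rimArc p L) with hx'
  have hin : ∀ n < ℓ, ∀ d, x' d (i + (n : ZMod m)) = x d (i + (n : ZMod m)) := fun n hn d =>
    kempe_notMem (by rw [hpe, add_mem_rimArc_add_iff i (by omega) (by omega)]; omega)
  have uαj : Uncovered (x' α) (i + (ℓ : ZMod m)) := by
    rw [hx', kempe_uncovered h.col.matching hL _ hjp (by rw [hp]; exact h.end_ne)]; exact h.unc_end
  have uci : Uncovered (x' c) i := by
    have := kempe_uncovered_right hL c
    rw [hp, Equiv.swap_apply_right] at this
    exact this.2 h.unc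
  have uother : ∀ d, d ≠ α → d ≠ c → x' d = x d := fun d h1 h2 => kempe_other h1 h2
  have hβx : x' β = x β := uother β h.ne.symm hcβ.symm
  rcases hσ : σ c with _ | k
  · exfalso
    refine absurd (hmax x' (Function.update σ c (some i))
      (h.col.kempe hL (fun d v hd => ?_) (h.col.bound.update h.unsat))) ?_
    · rcases eq_or_ne d c with rfl | hdc
      · simp at hd; exact hd ▸ uci
      rw [Function.update_of_ne hdc] at hd
      rcases eq_or_ne d α with rfl | hdα
      · rw [h.spoke] at hd; cases hd; exact uαj
      rw [kempe_other hdα hdc]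
      exact h.col.free _ _ hd
    · rw [spoked_update_none hσ, h.card]
      omega
  have hk : Uncovered (x c) k := h.col.free _ _ hσ
  have hki : k ≠ i := by rintro rfl; simp [hk.1] at hx
  -- If the spoke of `c` is at the far end, `c` takes the spoke at `i` and `α` the one at `p`. The
  -- vertex `i + ℓ` becomes unsaturated, and the `α`-`β` chain ending there now extends past `i` to
  -- the left.
  by_cases hkp : k = p
  · exfalso
    have hkj : k ≠ i + (ℓ : ZMod m) := by rw [hkp]; exact hjp.symm
    have hb2 := h.col.bound.update (c := c) h.unsat
    have hu2 := h.col.bound.unsaturated_update hσ hki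
    have hα2 : Function.update σ c (some i) α = some (i + (ℓ : ZMod m)) := by
      rw [Function.update_of_ne hcα.symm, h.spoke]
    have hu3 := hb2.unsaturated_update (v := k) hα2 hkj.symm
    have hb3 := hb2.update (c := α) hu2
    have uαk : Uncovered (x' α) k := by
      rw [hx', hkp, kempe_uncovered_left hL, Equiv.swap_apply_left, ← hkp]; exact hk
    set σ3 := Function.update (Function.update σ c (some i)) α (some k) with hσ3
    have hcol : IsColouring r s x' σ3 := h.col.kempe hL (fun d v hd => by
      rcases eq_or_ne d α with rfl | hdα
      · simp [hσ3] at hd; exact hd ▸ uαk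
      rw [hσ3, Function.update_of_ne hdα] at hd
      rcases eq_or_ne d c with rfl | hdc
      · simp at hd; exact hd ▸ uci
      rw [Function.update_of_ne hdc] at hd
      rw [kempe_other hdα hdc]
      exact h.col.free _ _ hd) hb3
    have hcard : spoked σ3 = N := by rw [hσ3, spoked_update_some hα2, spoked_update_some hσ, h.card]
    have hβ3 : σ3 β = none := by
      rw [hσ3, Function.update_of_ne h.ne.symm, Function.update_of_ne hcβ.symm, h.missing]
    obtain ⟨p2, L2, hL2, hp2⟩ := exists_chain_left (y := x' α) (z := x' β) (q := i + (ℓ : ZMod m))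
      (by rw [hβx, h.beta_end_pred, uαj.1]; simp) (by rw [hβx, h.beta_end, uαj.2])
    have hle := (hcol.chain_le hmax hlong hcard hu3 hβ3 uαj (by simp [hσ3]) hkj hL2
      (Or.inr hp2.symm)).1
    have hpa : p2 = i + ((ℓ - L2 : ℕ) : ZMod m) := by
      rw [Nat.cast_sub hle, eq_sub_of_add_eq hp2]; ring
    have hr := hL2.left
    rcases hle.lt_or_eq with hlt | rfl
    · have e : p2 - 1 = i + ((ℓ - L2 - 1 : ℕ) : ZMod m) := by
        rw [hpa, Nat.cast_sub (show 1 ≤ ℓ - L2 by omega)]; push_cast; ring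
      rw [e, hin _ (by omega), hin _ (by omega)] at hr
      exact h.chain.ne _ (by omega) hr
    · have e : p2 = i := by simpa using hpa
      rw [hβx, e, h.beta_pred, hx', kempe_left_mem, hx] at hr
      · simp at hr
      · exact mem_rimArc.2 ⟨L - 1, by omega, by rw [Nat.cast_sub hLpos, ← hp]; push_cast; ring⟩
  · have hcol : IsColouring r s x' σ := h.col.kempe hL (fun d v hd => by
      rcases eq_or_ne d α with rfl | hdα
      · rw [h.spoke] at hd; cases hd; exact uαj
      rcases eq_or_ne d c with rfl | hdc
      · rw [hσ] at hd; cases hd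
        rw [kempe_uncovered h.col.matching hL _ hkp (by rw [hp]; exact hki)]; exact hk
      rw [kempe_other hdα hdc]
      exact h.col.free _ _ hd) h.col.bound
    obtain ⟨L2, hL2⟩ := exists_chain_right (y := x' c) (z := x' β) (p := i)
      (by rw [hβx, h.beta_start, uci.2]; simp) (by rw [hβx, h.beta_pred, uci.1])
    obtain ⟨hle, hends⟩ := hcol.chain_le hmax hlong h.card h.unsat h.missing uci hσ hki hL2
      (Or.inl rfl)
    have hkp : k = i + (L2 : ZMod m) := by
      rcases hends with ⟨_, h2⟩ | ⟨_, h2⟩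
      · exact h2
      · exact absurd h2 hki
    refine ⟨L2, hL2.pos, hle, by rw [hkp], fun n h1 => ?_⟩
    have := hL2.ne n h1
    rwa [hin n (by omega), hin n (by omega)] at this

end IsAlternating

end Alternating

/-! ### How the other colours meet the longest chain, and crossing colours. -/

section Alternating

variable {m : ℕ} [NeZero m] {κ : Type*} [Fintype κ] [DecidableEq κ]
variable {r s : ZMod m → ℕ} {N : ℕ} {x x' : κ → ZMod m → Bool} {σ : κ → Option (ZMod m)}
  {i : ZMod m} {α β c d : κ} {ℓ : ℕ}

theorem add_natCast_ne (i : ZMod m) {a b : ℕ} (ha : a < m) (hb : b < m) (h : a ≠ b) :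
    i + (a : ZMod m) ≠ i + (b : ZMod m) := fun h' => h (ZMod.add_natCast_inj i ha hb h')

theorem add_natCast_sub_one (i : ZMod m) {a : ℕ} (ha : 0 < a) :
    i + (a : ZMod m) - 1 = i + ((a - 1 : ℕ) : ZMod m) := by
  rw [Nat.cast_sub ha]; push_cast; ring

theorem Bool.eq_of_ne_of_ne {a b c : Bool} (h1 : a ≠ b) (h2 : c ≠ b) : a = c := by
  cases a <;> cases b <;> cases c <;> simp_all

namespace IsAlternating

/-- A rigidity principle: as long as the spokes stay put and `α` stays missing at `i`, no
recolouring of the rim can change where this chain ends. -/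
theorem length_eq (h : IsAlternating r s N x σ i α β ℓ) (hmax : IsSpokeMax κ r s N)
    (hcol : IsColouring r s x' σ) (hu : Uncovered (x' α) i) {v : ℕ}
    (hc : RimChain (x' α) (x' β) i v) : v = ℓ := by
  rcases hcol.chain_end hmax h.card h.unsat h.missing hu h.spoke hc (Or.inl rfl) with h1 | h1
  · exact absurd h1 h.end_ne
  · exact (ZMod.add_natCast_inj i h.lt hc.lt h1).symm

theorem ne_zero_end (_ : IsAlternating r s N x σ i α β ℓ) {a : ℕ} (h0 : 0 < a) (ha : a < m) :
    i ≠ i + (a : ZMod m) := by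
  have := add_natCast_ne i (a := 0) (b := a) (by omega) ha (by omega)
  simpa using this

/-- Inside the alternating chain, every chain of `β` and another colour meets the spoke of that
colour. -/
theorem inner_beta (h : IsAlternating r s N x σ i α β ℓ) (hmax : IsSpokeMax κ r s N)
    (hdα : d ≠ α) {a L : ℕ} (hL : RimChain (x d) (x β) (i + (a : ZMod m)) L)
    (haL : a + L ≤ ℓ) (h1 : σ d ≠ some (i + (a : ZMod m)))
    (h2 : σ d ≠ some (i + ((a + L : ℕ) : ZMod m))) : False := by
  have hlt := h.lt
  have hpos := hL.pos
  have hcol := h.col.kempe_same hL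
    (fun v hv => ⟨fun h' => h1 (h' ▸ hv), fun h' => h2 (by push_cast; rw [← add_assoc, ← h', hv])⟩)
    (fun v hv => by simp [h.missing] at hv)
  have hα : kempe x d β (rimArc (i + (a : ZMod m)) L) α = x α := kempe_other hdα.symm h.ne
  have hβ : ∀ n < m, n < a ∨ a + L ≤ n →
      kempe x d β (rimArc (i + (a : ZMod m)) L) β (i + (n : ZMod m)) = x β (i + (n : ZMod m)) := by
    intro n hn hna
    exact kempe_notMem (by rw [add_mem_rimArc_add_iff i hn (by omega)]; omega)
  rcases Nat.eq_zero_or_pos a with rfl | ha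
  · refine hcol.not_uncovered hmax h.card h.unsat h.missing ?_
    simp only [Nat.cast_zero, add_zero] at hL ⊢
    rw [kempe_uncovered_left hL, Equiv.swap_apply_right]
    rcases hL.uncovered_left h.col.matching with h3 | h3
    · exact h3.1
    · have := h.beta_start
      simp [h3.2.2] at this
  · have := h.length_eq hmax hcol (by rw [hα]; exact h.unc) (v := a) ⟨ha, by omega, fun n hn => ?_, ?_, ?_⟩
    · omega
    · rw [hα, hβ n (by omega) (Or.inl hn)]
      exact h.chain.ne n (by omega)
    · have := hβ (m - 1) (by omega) (by omega)
      rw [ZMod.add_natCast_pred] at this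
      rw [hα, this]; exact h.chain.left
    · rw [hα, kempe_right_mem (mem_rimArc.2 ⟨0, hpos, by simp⟩)]
      refine Bool.eq_of_ne_of_ne (h.chain.ne a (by omega)) ?_
      simpa using hL.ne 0 hpos

/-- Strictly inside the alternating chain, every chain of `α` and another colour meets the spoke of
that colour. -/
theorem inner_alpha (h : IsAlternating r s N x σ i α β ℓ) (hmax : IsSpokeMax κ r s N)
    (hdβ : d ≠ β) {a L : ℕ} (hL : RimChain (x d) (x α) (i + (a : ZMod m)) L)
    (ha : 0 < a) (haL : a + L < ℓ) (h1 : σ d ≠ some (i + (a : ZMod m)))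
    (h2 : σ d ≠ some (i + ((a + L : ℕ) : ZMod m))) : False := by
  have hlt := h.lt
  have hpos := hL.pos
  have hcol := h.col.kempe_same hL
    (fun v hv => ⟨fun h' => h1 (h' ▸ hv), fun h' => h2 (by push_cast; rw [← add_assoc, ← h', hv])⟩)
    (fun v hv => by
      rw [h.spoke] at hv; cases hv
      refine ⟨add_natCast_ne i hlt (by omega) (by omega), ?_⟩
      rw [add_assoc, ← Nat.cast_add]
      exact add_natCast_ne i hlt (by omega) (by omega))
  have hβ : kempe x d α (rimArc (i + (a : ZMod m)) L) β = x β := kempe_other hdβ.symm h.ne.symm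
  have hα : ∀ n < m, n < a ∨ a + L ≤ n →
      kempe x d α (rimArc (i + (a : ZMod m)) L) α (i + (n : ZMod m)) = x α (i + (n : ZMod m)) := by
    intro n hn hna
    exact kempe_notMem (by rw [add_mem_rimArc_add_iff i hn (by omega)]; omega)
  have hu : Uncovered (kempe x d α (rimArc (i + (a : ZMod m)) L) α) i := by
    rw [kempe_uncovered h.col.matching hL _ (h.ne_zero_end ha (by omega))]
    · exact h.unc
    · rw [add_assoc, ← Nat.cast_add]
      exact h.ne_zero_end (by omega) (by omega)
  -- As for `β`, the long chain is cut at offset `a`. Lying strictly inside, the interchanged chain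
  -- avoids `i` and the spoke of `α`.
  have := h.length_eq hmax hcol hu (v := a) ⟨ha, by omega, fun n hn => ?_, ?_, ?_⟩
  · omega
  · rw [hβ, hα n (by omega) (Or.inl hn)]
    exact h.chain.ne n (by omega)
  · have := hα (m - 1) (by omega) (by omega)
    rw [ZMod.add_natCast_pred] at this
    rw [hβ, this]; exact h.chain.left
  · rw [hβ, kempe_right_mem (mem_rimArc.2 ⟨0, hpos, by simp⟩)]
    refine (Bool.eq_of_ne_of_ne (b := x α (i + (a : ZMod m))) ?_ ?_)
    · simpa using hL.ne 0 hpos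
    · exact (h.chain.ne a (by omega)).symm

/-- The spoke of colour `d` is at an end of the chain of `d` and `β` that ends at `i + v`. -/
def SpokeOnChain (x : κ → ZMod m → Bool) (σ : κ → Option (ZMod m)) (i : ZMod m) (β d : κ) (v : ℕ) :
    Prop :=
  σ d = some (i + (v : ZMod m)) ∨ ∃ a < v, σ d = some (i + (a : ZMod m)) ∧
    ∀ n, a ≤ n → n < v → x d (i + (n : ZMod m)) ≠ x β (i + (n : ZMod m))

theorem beta_odd (h : IsAlternating r s N x σ i α β ℓ) {v : ℕ} (hv : v % 2 = 1) (hvℓ : v ≤ ℓ) :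
    x β (i + (v : ZMod m)) = false := by
  rcases hvℓ.lt_or_eq with h1 | rfl
  · rw [(h.vals h1).2]; simp; omega
  · exact h.beta_end

/-- At an odd offset `v` the colour `β` has the edge before and not the edge after, so a `d`-`β`
chain ends there from the left. If it stays in the arc, `inner_beta` applies; if it runs out past
`i`, then `d` has the edge `i - 1` and `exit_left` applies. -/
theorem spokeOnChain_inner (h : IsAlternating r s N x σ i α β ℓ) (hmax : IsSpokeMax κ r s N)
    (hlong : IsLongest κ r s N ℓ) (hdα : d ≠ α) (hdβ : d ≠ β) (hn : ¬ Crossing x i α ℓ d)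
    {v : ℕ} (hv : v % 2 = 1) (hvℓ : v ≤ ℓ) (hu : Uncovered (x d) (i + (v : ZMod m))) :
    SpokeOnChain x σ i β d v := by
  have hlt := h.lt
  have hvpos : 0 < v := by omega
  have hu1 := hu.1
  have hβ1 : x β (i + (v : ZMod m)) = false := h.beta_odd hv hvℓ
  have hβ2 : x β (i + (v : ZMod m) - 1) = true := by
    rw [add_natCast_sub_one i hvpos, (h.vals (by omega)).2]; simp; omega
  obtain ⟨p, L, hL, hp⟩ := exists_chain_left (y := x d) (z := x β) (q := i + (v : ZMod m))
    (by rw [hβ2, hu1]; simp) (by rw [hβ1, hu.2])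
  have hLpos := hL.pos
  by_cases hLv : L ≤ v
  · have hpe : p = i + ((v - L : ℕ) : ZMod m) := by
      rw [Nat.cast_sub hLv, eq_sub_of_add_eq hp]; ring
    by_contra hcon
    unfold SpokeOnChain at hcon
    push Not at hcon
    subst hpe
    refine h.inner_beta hmax hdα hL (by omega) (fun h' => ?_) ?_
    · obtain ⟨n, hn1, hn2, hn3⟩ := hcon.2 _ (by omega) h'
      refine hL.ne (n - (v - L)) (by omega) ?_
      rw [add_assoc, ← Nat.cast_add, Nat.add_sub_cancel' hn1, hn3]
    · rw [show v - L + L = v by omega]; exact hcon.1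
  · have hD : ∀ n : ℕ, n < v → x d (i + (n : ZMod m)) ≠ x β (i + (n : ZMod m)) := by
      intro n hn
      have := hL.ne (L - (v - n)) (by omega)
      have e : p + ((L - (v - n) : ℕ) : ZMod m) = i + (n : ZMod m) := by
        rw [eq_sub_of_add_eq hp, Nat.cast_sub (by omega), Nat.cast_sub hn.le]; ring
      rwa [e] at this
    have hpred := hL.ne (L - v - 1) (by omega)
    have e : p + ((L - v - 1 : ℕ) : ZMod m) = i - 1 := by
      rw [eq_sub_of_add_eq hp, Nat.cast_sub (by omega), Nat.cast_sub (by omega)]; push_cast; ring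
    rw [e, h.beta_pred] at hpred
    obtain ⟨b, hb0, hbℓ, hb, hbD⟩ := h.exit_left hmax hlong hdα hdβ (by simpa using hpred) hn
    rcases lt_trichotomy b v with hbv | rfl | hbv
    · exfalso
      -- `d` is missing at `i + b` but differs from `β` on both edges there, so `β` would have two
      -- consecutive edges.
      have hub := h.col.free _ _ hb
      have k1 := hD b hbv
      have k2 := hD (b - 1) (by omega)
      have k3 := h.col.matching β (i + ((b - 1 : ℕ) : ZMod m))
      rw [← add_natCast_sub_one i hb0, sub_add_cancel] at k3
      rw [← add_natCast_sub_one i hb0, hub.1] at k2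
      rw [hub.2] at k1
      have k4 : x β (i + (b : ZMod m) - 1) = true := by simpa using k2.symm
      exact k1 (k3 k4).symm
    · exact Or.inl hb
    · exact absurd (hu.2.trans hβ1.symm) (hbD v hbv)

theorem not_crossing_alpha (h : IsAlternating r s N x σ i α β ℓ) : ¬ Crossing x i α ℓ α :=
  fun hc => hc ℓ le_rfl h.lt rfl

theorem not_crossing_beta (h : IsAlternating r s N x σ i α β ℓ) : ¬ Crossing x i α ℓ β :=
  fun hc => hc ℓ le_rfl h.lt (by rw [h.beta_end, h.unc_end.2])

theorem crossing_end (h : IsAlternating r s N x σ i α β ℓ) (hc : Crossing x i α ℓ c) :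
    x c (i + (ℓ : ZMod m)) = true := by
  have := hc ℓ le_rfl h.lt
  rw [h.unc_end.2] at this
  simpa using this

theorem crossing_pred (h : IsAlternating r s N x σ i α β ℓ) (hc : Crossing x i α ℓ c) :
    x c (i - 1) = true := by
  have hlt := h.lt
  have := hc (m - 1) (by omega) (by omega)
  rw [ZMod.add_natCast_pred, h.unc.1] at this
  simpa using this

theorem crossing_vals (h : IsAlternating r s N x σ i α β ℓ) (hc : Crossing x i α ℓ c) {n : ℕ}
    (hn : ℓ ≤ n) (hnm : n < m) :
    x α (i + (n : ZMod m)) = decide (n % 2 = 0) ∧ x c (i + (n : ZMod m)) = decide (n % 2 = 1) := by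
  induction n, hn using Nat.le_induction with
  | base =>
    have := h.odd
    rw [h.unc_end.2, h.crossing_end hc]
    simp; omega
  | succ n hn ih =>
    obtain ⟨h1, h2⟩ := ih (by omega)
    have h3 := hc (n + 1) (by omega) hnm
    have a1 := h.col.matching α (i + (n : ZMod m))
    have a2 := h.col.matching c (i + (n : ZMod m))
    have e : i + ((n + 1 : ℕ) : ZMod m) = i + (n : ZMod m) + 1 := by push_cast; ring
    rw [e] at h3 ⊢
    rcases Nat.mod_two_eq_zero_or_one n with h0 | h0
    · have : (n + 1) % 2 = 1 := by omega
      simp only [h0, this] at *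
      simp at *
      grind
    · have : (n + 1) % 2 = 0 := by omega
      simp only [h0, this] at *
      simp at *
      grind

/-- Outside the chain `α` occupies exactly the even offsets, and it does not occupy the last offset
`m - 1`. -/
theorem crossing_even (h : IsAlternating r s N x σ i α β ℓ) (hc : Crossing x i α ℓ c) :
    m % 2 = 0 := by
  have hlt := h.lt
  have h1 := (h.crossing_vals hc (n := m - 1) (by omega) (by omega)).1
  rw [ZMod.add_natCast_pred, h.unc.1] at h1
  simp at h1
  omega

/-- If some colour differs from `α` on all edges outside the alternating chain, then `α` and `β`
agree on these edges. -/
theorem beta_eq_alpha (h : IsAlternating r s N x σ i α β ℓ) (hmax : IsSpokeMax κ r s N)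
    (hlong : IsLongest κ r s N ℓ) (hc : Crossing x i α ℓ c) {n : ℕ} (hn : ℓ ≤ n) (hnm : n < m) :
    x β (i + (n : ZMod m)) = x α (i + (n : ZMod m)) := by
  classical
  by_contra hne
  have hex : ∃ n, ℓ ≤ n ∧ n < m ∧ x β (i + (n : ZMod m)) ≠ x α (i + (n : ZMod m)) := ⟨n, hn, hnm, hne⟩
  -- The first disagreement outside starts a second `α`-`β` chain, disjoint from the long one and
  -- from the spoke of `α`. Interchanging it keeps the configuration alternating with the same `ℓ`.
  obtain ⟨q, ⟨hq1, hq2, hq3⟩, hqmin⟩ := Nat.findX hex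
  have hcα : c ≠ α := by rintro rfl; exact h.not_crossing_alpha hc
  have hcβ : c ≠ β := by rintro rfl; exact h.not_crossing_beta hc
  have hlt := h.lt
  have hqℓ : ℓ < q := by
    refine lt_of_le_of_ne hq1 ?_
    rintro rfl
    exact hq3 (by rw [h.beta_end, h.unc_end.2])
  have hqp : x α (i + (q : ZMod m) - 1) = x β (i + (q : ZMod m) - 1) := by
    rw [add_natCast_sub_one i (by omega)]
    by_contra h'
    exact hqmin (q - 1) (by omega) ⟨by omega, by omega, Ne.symm h'⟩
  obtain ⟨L, hL⟩ := exists_chain_right (y := x α) (z := x β) (Ne.symm hq3) hqp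
  have hLpos := hL.pos
  have hLm : q + L < m := by
    by_contra h'
    refine hL.ne (m - 1 - q) (by omega) ?_
    rw [add_assoc, ← Nat.cast_add, Nat.add_sub_cancel' (by omega), ZMod.add_natCast_pred,
      h.beta_pred, h.unc.1]
  have hend : i + (q : ZMod m) + (L : ZMod m) = i + ((q + L : ℕ) : ZMod m) := by push_cast; ring
  set x' := kempe x α β (rimArc (i + (q : ZMod m)) L) with hx'
  have hout : ∀ n < m, n < q ∨ q + L ≤ n → ∀ d, x' d (i + (n : ZMod m)) = x d (i + (n : ZMod m)) := by
    intro n hn hna d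
    exact kempe_notMem (by rw [add_mem_rimArc_add_iff i hn (by omega)]; omega)
  have hcol : IsColouring r s x' σ := h.col.kempe_same hL
    (fun v hv => by
      rw [h.spoke] at hv; cases hv
      rw [hend]
      exact ⟨add_natCast_ne i hlt hq2 (by omega), add_natCast_ne i hlt hLm (by omega)⟩)
    (fun v hv => by simp [h.missing] at hv)
  have halt : IsAlternating r s N x' σ i α β ℓ := by
    refine ⟨hcol, h.card, h.unsat, h.spoke, h.missing, ?_, h.chain.pos, hlt, fun n hn => ?_, ?_, ?_⟩
    · rw [hx', kempe_uncovered h.col.matching hL _ (h.ne_zero_end (by omega) hq2)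
        (by rw [hend]; exact h.ne_zero_end (by omega) hLm)]
      exact h.unc
    · rw [hout n (by omega) (by omega), hout n (by omega) (by omega)]
      exact h.chain.ne n hn
    · rw [← ZMod.add_natCast_pred, hout _ (by omega) (by omega), hout _ (by omega) (by omega),
        ZMod.add_natCast_pred]
      exact h.chain.left
    · rw [hout _ (by omega) (by omega), hout _ (by omega) (by omega)]
      exact h.chain.right
  have hx'c : x' c = x c := kempe_other hcα hcβ
  -- At `q` the new `α` has the old value of `β`, which is that of `c`. So `c` is no longer crossing
  -- and both exit lemmas apply to it.
  have hnc : ¬ Crossing x' i α ℓ c := fun hc' => by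
    have k1 := hc' q hq1 hq2
    have k2 := hc q hq1 hq2
    rw [hx'c, hx', kempe_left_mem (mem_rimArc.2 ⟨0, hLpos, by simp⟩)] at k1
    exact k1 (Bool.eq_of_ne_of_ne k2 hq3)
  obtain ⟨a, ha1, ha2, ha3⟩ := halt.exit_right hmax hlong hcα hcβ (by rw [hx'c]; exact h.crossing_end hc) hnc
  obtain ⟨b, hb1, hb2, hb3, hb4⟩ := halt.exit_left hmax hlong hcα hcβ (by rw [hx'c]; exact h.crossing_pred hc) hnc
  have hab : a = b := ZMod.add_natCast_inj i (by omega) (by omega) (Option.some.inj (ha2.symm.trans hb3))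
  subst hab
  -- Both exits find the same spoke of `c`, at an inner vertex where `c` is missing and differs from
  -- `β` on both edges: `β` would have two consecutive edges.
  have hu := halt.col.free _ _ ha2
  have k1 := ha3 a le_rfl ha1
  have k2 := hb4 (a - 1) (by omega)
  have k3 := halt.col.matching β (i + (a : ZMod m) - 1)
  rw [sub_add_cancel] at k3
  rw [← add_natCast_sub_one i hb1, hu.1] at k2
  rw [hu.2] at k1
  exact k1 (k3 (by simpa using k2.symm)).symm

theorem crossing_beta (h : IsAlternating r s N x σ i α β ℓ) (hmax : IsSpokeMax κ r s N)
    (hlong : IsLongest κ r s N ℓ) (hc : Crossing x i α ℓ c) {n : ℕ} (hnm : n < m) :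
    x β (i + (n : ZMod m)) = decide (n % 2 = 0) := by
  rcases lt_or_ge n ℓ with hn | hn
  · exact (h.vals hn).2
  · rw [h.beta_eq_alpha hmax hlong hc hn hnm, (h.crossing_vals hc hn hnm).1]

/-- With a crossing colour present, `β` alternates around the whole rim, so a `d`-`β` chain again
ends at `v` from the left. If it reaches back to `i + ℓ`, `exit_right` applies; otherwise
interchanging it would contradict the rigidity of `β` in `crossing_beta`. -/
theorem spokeOnChain_outer (h : IsAlternating r s N x σ i α β ℓ) (hmax : IsSpokeMax κ r s N)
    (hlong : IsLongest κ r s N ℓ) (hc : Crossing x i α ℓ c) (hdα : d ≠ α) (hdβ : d ≠ β)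
    (hn : ¬ Crossing x i α ℓ d) {v : ℕ} (hv : v % 2 = 1) (hvℓ : ℓ < v) (hvm : v < m)
    (hu : Uncovered (x d) (i + (v : ZMod m))) : SpokeOnChain x σ i β d v := by
  have hlt := h.lt
  have hpos := h.chain.pos
  have hvpos : 0 < v := by omega
  have hu1 := hu.1
  have hβ1 : x β (i + (v : ZMod m)) = false := by
    rw [h.crossing_beta hmax hlong hc hvm]; simp; omega
  have hβ2 : x β (i + (v : ZMod m) - 1) = true := by
    rw [add_natCast_sub_one i hvpos, h.crossing_beta hmax hlong hc (by omega)]; simp; omega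
  obtain ⟨p, L, hL, hp⟩ := exists_chain_left (y := x d) (z := x β) (q := i + (v : ZMod m))
    (by rw [hβ2, hu1]; simp) (by rw [hβ1, hu.2])
  have hLpos := hL.pos
  have hLm := hL.lt
  have hD : ∀ n : ℕ, v - L ≤ n → n < v → x d (i + (n : ZMod m)) ≠ x β (i + (n : ZMod m)) := by
    intro n hn1 hn
    have := hL.ne (L - (v - n)) (by omega)
    have e : p + ((L - (v - n) : ℕ) : ZMod m) = i + (n : ZMod m) := by
      rw [eq_sub_of_add_eq hp, Nat.cast_sub (by omega), Nat.cast_sub hn.le]; ring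
    rwa [e] at this
  by_cases hLv : L < v - ℓ
  · have hpe : p = i + ((v - L : ℕ) : ZMod m) := by
      rw [Nat.cast_sub (by omega), eq_sub_of_add_eq hp]; ring
    by_contra hcon
    unfold SpokeOnChain at hcon
    push Not at hcon
    have h1 : σ d ≠ some p := fun h' => by
      obtain ⟨n, hn1, hn2, hn3⟩ := hcon.2 (v - L) (by omega) (by rw [h', hpe])
      exact hD n hn1 hn2 hn3
    have h2 : σ d ≠ some (p + (L : ZMod m)) := by rw [hp]; exact hcon.1
    set x' := kempe x d β (rimArc p L) with hx'
    have hcol : IsColouring r s x' σ := h.col.kempe_same hL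
      (fun w hw => ⟨fun h' => h1 (h' ▸ hw), fun h' => h2 (h' ▸ hw)⟩)
      (fun w hw => by simp [h.missing] at hw)
    have hα : x' α = x α := kempe_other hdα.symm h.ne
    have hβ : ∀ n < m, n < v - L ∨ v ≤ n → x' β (i + (n : ZMod m)) = x β (i + (n : ZMod m)) := by
      intro n hn hna
      exact kempe_notMem (by rw [hpe, add_mem_rimArc_add_iff i hn (by omega)]; omega)
    have halt : IsAlternating r s N x' σ i α β ℓ := by
      refine ⟨hcol, h.card, h.unsat, h.spoke, h.missing, by rw [hα]; exact h.unc, hpos, hlt,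
        fun n hn => ?_, ?_, ?_⟩
      · rw [hα, hβ n (by omega) (by omega)]; exact h.chain.ne n hn
      · rw [hα, ← ZMod.add_natCast_pred, hβ _ (by omega) (by omega), ZMod.add_natCast_pred]
        exact h.chain.left
      · rw [hα, hβ _ (by omega) (by omega)]; exact h.chain.right
    have hcd : c ≠ d := by rintro rfl; exact hn hc
    have hcβ : c ≠ β := by rintro rfl; exact h.not_crossing_beta hc
    have hc' : Crossing x' i α ℓ c := by
      intro n hn1 hn2
      rw [hα, hx', kempe_other hcd hcβ]
      exact hc n hn1 hn2
    -- After the interchange `c` is still crossing, so `β` must still own the edge `v - 1`; but it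
    -- has just lost it to `d`.
    have k1 := halt.crossing_beta hmax hlong hc' (n := v - 1) (by omega)
    have k2 : x' β (i + ((v - 1 : ℕ) : ZMod m)) = x d (i + ((v - 1 : ℕ) : ZMod m)) :=
      kempe_right_mem (by rw [hpe, add_mem_rimArc_add_iff i (by omega) (by omega)]; omega)
    rw [k2, ← add_natCast_sub_one i hvpos, hu1] at k1
    simp at k1
    omega
  · have hx : x d (i + (ℓ : ZMod m)) = true := by
      have := hD ℓ (by omega) hvℓ
      rw [h.beta_end] at this
      simpa using this
    obtain ⟨a, ha1, ha2, ha3⟩ := h.exit_right hmax hlong hdα hdβ hx hn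
    refine Or.inr ⟨a, by omega, ha2, fun n h1 h2 => ?_⟩
    rcases lt_or_ge n ℓ with h3 | h3
    · exact ha3 n h1 h3
    · exact hD n (by omega) h2

/-- A crossing colour has all odd offsets from `ℓ` on, so `v < ℓ`. The `d`-`α` chain from `v` stops
before the last edge of the arc, which neither colour has, so `inner_alpha` puts the spoke at one of
its ends. -/
theorem crossing_spoke (h : IsAlternating r s N x σ i α β ℓ) (hmax : IsSpokeMax κ r s N)
    (hd : Crossing x i α ℓ d) {v : ℕ} (hv : v % 2 = 1) (hvm : v < m)
    (hu : Uncovered (x d) (i + (v : ZMod m))) :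
    v < ℓ ∧ ∃ w < m, v < w ∧ (σ d = some (i + (v : ZMod m)) ∨ σ d = some (i + (w : ZMod m))) ∧
      ∀ n, v ≤ n → n < w → x d (i + (n : ZMod m)) ≠ x α (i + (n : ZMod m)) := by
  have hlt := h.lt
  have hdβ : d ≠ β := by rintro rfl; exact h.not_crossing_beta hd
  have hvℓ : v < ℓ := by
    by_contra h'
    have := (h.crossing_vals hd (n := v) (by omega) hvm).2
    rw [hu.2] at this
    simp at this
    omega
  have hα1 : x α (i + (v : ZMod m)) = true := by rw [(h.vals hvℓ).1]; simp; omega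
  obtain ⟨L, hL⟩ := exists_chain_right (y := x d) (z := x α) (p := i + (v : ZMod m))
    (by rw [hα1, hu.2]; simp) (by rw [hu.1, (h.col.matching α).pred hα1])
  have hLpos := hL.pos
  have hle : L ≤ ℓ - 1 - v := hL.length_eq (by
    rw [add_assoc, ← Nat.cast_add, Nat.add_sub_cancel' (by omega),
      ← add_natCast_sub_one i (by omega), h.unc_end.1, (h.col.matching d).pred (h.crossing_end hd)])
  refine ⟨hvℓ, v + L, by omega, by omega, ?_, fun n h1 h2 => ?_⟩
  · by_contra hcon
    push Not at hcon
    exact h.inner_alpha hmax hdβ hL (by omega) (by omega) hcon.1 hcon.2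
  · have := hL.ne (n - v) (by omega)
    rwa [add_assoc, ← Nat.cast_add, Nat.add_sub_cancel' h1] at this

/-- A colour has one spoke, so it lies at or before `v`. The chain from it to `w` then passes over
the edge at `v`, which neither `d` nor `β` has. -/
theorem spokeOnChain_unique {v w : ℕ} (hvw : v < w) (hwm : w < m)
    (h1 : SpokeOnChain x σ i β d v) (h2 : SpokeOnChain x σ i β d w)
    (hu : Uncovered (x d) (i + (v : ZMod m))) (hβ : x β (i + (v : ZMod m)) = false) : False := by
  obtain ⟨a, hav, ha⟩ : ∃ a ≤ v, σ d = some (i + (a : ZMod m)) := by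
    rcases h1 with h1 | ⟨a, h, h', _⟩
    · exact ⟨v, le_rfl, h1⟩
    · exact ⟨a, h.le, h'⟩
  rcases h2 with h2 | ⟨b, hb, h2, h3⟩
  · have := ZMod.add_natCast_inj i (a := a) (b := w) (by omega) hwm (Option.some.inj (ha.symm.trans h2))
    omega
  · have := ZMod.add_natCast_inj i (a := a) (b := b) (by omega) (by omega)
      (Option.some.inj (ha.symm.trans h2))
    subst this
    exact h3 v hav hvw (by rw [hu.2, hβ])

end IsAlternating

end Alternating

/-! ### Counting the edges of each colour, and the contradiction with the odd-set bounds. -/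

theorem exists_greatest_of_le {P : ℕ → Prop} (h0 : ∃ n, P n) (B : ℕ) (hB : ∀ n, P n → n ≤ B) :
    ∃ n, P n ∧ ∀ k, P k → k ≤ n := by
  classical
  obtain ⟨n, hn⟩ := h0
  exact ⟨Nat.findGreatest P B, Nat.findGreatest_spec (hB n hn) hn,
    fun k hk => Nat.le_findGreatest (hB k hk) hk⟩

/-- Among the first `2 * h` terms of a sequence of truth values, at least `h` minus the number of
pairs `2 * k, 2 * k + 1` of false terms are true. -/
theorem le_sum_pairs (y : ℕ → Bool) (h : ℕ) :
    h ≤ (∑ n ∈ Finset.range (2 * h), if y n = true then 1 else 0) +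
      ((Finset.range h).filter fun k => y (2 * k) = false ∧ y (2 * k + 1) = false).card := by
  induction h with
  | zero => simp
  | succ h ih =>
    rw [show 2 * (h + 1) = 2 * h + 1 + 1 by ring, Finset.sum_range_succ, Finset.sum_range_succ,
      Finset.range_add_one, Finset.filter_insert]
    cases h1 : y (2 * h) <;> cases h2 : y (2 * h + 1) <;> simp at ih ⊢ <;> omega

section Count

variable {m : ℕ} [NeZero m]

theorem sum_range_add_natCast (i : ZMod m) (f : ZMod m → ℕ) :
    ∑ n ∈ Finset.range m, f (i + (n : ZMod m)) = ∑ e, f e := by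
  refine Finset.sum_bij (fun n _ => i + (n : ZMod m)) (by simp) ?_ ?_ (by simp)
  · intro a ha b hb h
    exact ZMod.add_natCast_inj i (Finset.mem_range.1 ha) (Finset.mem_range.1 hb) h
  · intro e _
    obtain ⟨n, hn, rfl⟩ := ZMod.exists_add_natCast i e
    exact ⟨n, Finset.mem_range.2 hn, rfl⟩

variable {κ : Type*} [Fintype κ] [DecidableEq κ]

theorem spoked_eq_sum (σ : κ → Option (ZMod m)) : spoked σ = ∑ v, spokeCount σ v := by
  unfold spoked spokeCount
  rw [← Finset.card_biUnion]
  · congr 1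
    ext c
    simp [Option.ne_none_iff_exists']
  · intro a _ b _ hab
    rw [Function.onFun, Finset.disjoint_left]
    intro c hc hc'
    simp only [Finset.mem_filter, Finset.mem_univ, true_and] at hc hc'
    exact hab (Option.some.inj (hc.symm.trans hc'))

variable {r s : ZMod m → ℕ} {N : ℕ} {x : κ → ZMod m → Bool} {σ : κ → Option (ZMod m)}
  {i : ZMod m} {α β c d : κ} {ℓ : ℕ}

theorem IsColouring.sum_rim (h : IsColouring r s x σ) (L : ℕ) :
    ∑ c, ∑ n ∈ Finset.range L, (if x c (i + (n : ZMod m)) = true then 1 else 0) =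
      ∑ n ∈ Finset.range L, r (i + (n : ZMod m)) := by
  rw [Finset.sum_comm]
  refine Finset.sum_congr rfl fun n _ => ?_
  rw [← h.rim, Finset.card_filter]

namespace IsAlternating

theorem uncovered_pair {x : κ → ZMod m → Bool} {k : ℕ}
    (h : x d (i + ((2 * k : ℕ) : ZMod m)) = false ∧ x d (i + ((2 * k + 1 : ℕ) : ZMod m)) = false) :
    Uncovered (x d) (i + ((2 * k + 1 : ℕ) : ZMod m)) :=
  ⟨by rw [add_natCast_sub_one i (by omega)]; exact h.1, h.2⟩

/-- The single spoke forces the `d`-`α` chain from `v` to reach `w` or beyond, across the edge `w -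
1`, which neither colour has. -/
theorem crossing_unique (h : IsAlternating r s N x σ i α β ℓ) (hmax : IsSpokeMax κ r s N)
    (hd : Crossing x i α ℓ d) {v w : ℕ} (hv : v % 2 = 1) (hw : w % 2 = 1) (hvw : v < w)
    (hwm : w < m) (hu : Uncovered (x d) (i + (v : ZMod m)))
    (hu' : Uncovered (x d) (i + (w : ZMod m))) : False := by
  obtain ⟨hv1, a, ham, hva, h1, hD⟩ := h.crossing_spoke hmax hd hv (by omega) hu
  obtain ⟨hw1, b, hbm, hwb, h2, _⟩ := h.crossing_spoke hmax hd hw hwm hu'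
  have hwa : w ≤ a := by
    rcases h1 with h1 | h1 <;> rcases h2 with h2 | h2 <;>
    · have := ZMod.add_natCast_inj i (by omega) (by omega) (Option.some.inj (h1.symm.trans h2))
      omega
  refine hD (w - 1) (by omega) (by omega) ?_
  rw [(h.vals (n := w - 1) (by omega)).1, ← add_natCast_sub_one i (by omega), hu'.1]
  simp; omega

/-- The arc inequality fails if no colour is crossing. -/
theorem arc_violated (h : IsAlternating r s N x σ i α β ℓ) (hmax : IsSpokeMax κ r s N)
    (hlong : IsLongest κ r s N ℓ) (hn : ∀ d, ¬ Crossing x i α ℓ d) :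
    Fintype.card κ * ((ℓ + 1) / 2) < ∑ n ∈ Finset.range ℓ, r (i + (n : ZMod m)) +
      ∑ n ∈ Finset.range (ℓ + 1), s (i + (n : ZMod m)) := by
  classical
  have hodd := h.odd
  have hlt := h.lt
  -- The offsets `0, …, ℓ` are paired as `2k, 2k + 1`. The last one, `ℓ`, lies outside the arc. A
  -- colour loses one unit by an empty pair or by spending its edge at `ℓ`; at most one such loss
  -- occurs, and a spoke to the arc makes up for it.
  have key : ∀ d, (ℓ + 1) / 2 ≤ (∑ n ∈ Finset.range ℓ, if x d (i + (n : ZMod m)) = true then 1 else 0) +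
      if ∃ n < ℓ + 1, σ d = some (i + (n : ZMod m)) then 1 else 0 := by
    intro d
    have hp := le_sum_pairs (fun n => x d (i + (n : ZMod m))) ((ℓ + 1) / 2)
    rw [show 2 * ((ℓ + 1) / 2) = ℓ + 1 by omega, Finset.sum_range_succ] at hp
    have e1 : ∀ k < (ℓ + 1) / 2, x d (i + ((2 * k : ℕ) : ZMod m)) = false ∧
        x d (i + ((2 * k + 1 : ℕ) : ZMod m)) = false → ∃ n < ℓ + 1, σ d = some (i + (n : ZMod m)) := by
      intro k hk hU
      by_cases hdα : d = α
      · exact ⟨ℓ, by omega, by rw [hdα, h.spoke]⟩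
      by_cases hdβ : d = β
      · have := (h.vals (n := 2 * k) (by omega)).2
        rw [← hdβ, hU.1] at this
        simp at this
      rcases h.spokeOnChain_inner hmax hlong hdα hdβ (hn d) (v := 2 * k + 1) (by omega) (by omega)
        (uncovered_pair hU) with h1 | ⟨a, ha, h1, _⟩
      · exact ⟨_, by omega, h1⟩
      · exact ⟨_, by omega, h1⟩
    have e2 : x d (i + (ℓ : ZMod m)) = true → d ≠ α ∧ d ≠ β := by
      intro hx
      constructor
      · rintro rfl; simp [h.unc_end.2] at hx
      · rintro rfl; simp [h.beta_end] at hx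
    have e3 : x d (i + (ℓ : ZMod m)) = true → SpokeOnChain x σ i β d ℓ := by
      intro hx
      obtain ⟨a, ha, h1, h2⟩ := h.exit_right hmax hlong (e2 hx).1 (e2 hx).2 hx (hn d)
      exact Or.inr ⟨a, ha, h1, h2⟩
    have e4 : ∀ k < (ℓ + 1) / 2, x d (i + ((2 * k : ℕ) : ZMod m)) = false ∧
        x d (i + ((2 * k + 1 : ℕ) : ZMod m)) = false → ∀ w, 2 * k + 1 < w → w ≤ ℓ →
        SpokeOnChain x σ i β d w → d ≠ α → d ≠ β → False := by
      intro k hk hU w h1 h2 h3 hdα hdβ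
      exact spokeOnChain_unique h1 (by omega) (h.spokeOnChain_inner hmax hlong hdα hdβ (hn d)
        (by omega) (by omega) (uncovered_pair hU)) h3 (uncovered_pair hU)
        (h.beta_odd (by omega) (by omega))
    have e5 : ∀ k < (ℓ + 1) / 2, (x d (i + ((2 * k : ℕ) : ZMod m)) = false ∧
        x d (i + ((2 * k + 1 : ℕ) : ZMod m)) = false) → x d (i + (ℓ : ZMod m)) = false := by
      intro k hk hU
      by_contra hx
      have hx : x d (i + (ℓ : ZMod m)) = true := by simpa using hx
      rcases (show 2 * k + 1 ≤ ℓ by omega).lt_or_eq with h1 | h1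
      · exact e4 k hk hU ℓ h1 le_rfl (e3 hx) (e2 hx).1 (e2 hx).2
      · rw [h1, hx] at hU; simp at hU
    have e6 : ∀ k < (ℓ + 1) / 2, (x d (i + ((2 * k : ℕ) : ZMod m)) = false ∧
        x d (i + ((2 * k + 1 : ℕ) : ZMod m)) = false) → ∀ k' < (ℓ + 1) / 2,
        (x d (i + ((2 * k' : ℕ) : ZMod m)) = false ∧
        x d (i + ((2 * k' + 1 : ℕ) : ZMod m)) = false) → ¬ k < k' := by
      intro k hk hU k' hk' hU' hlt'
      by_cases hdα : d = α
      · have := (h.vals (n := 2 * k + 1) (by omega)).1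
        rw [← hdα, hU.2] at this
        simp at this
      by_cases hdβ : d = β
      · have := (h.vals (n := 2 * k) (by omega)).2
        rw [← hdβ, hU.1] at this
        simp at this
      exact e4 k hk hU (2 * k' + 1) (by omega) (by omega) (h.spokeOnChain_inner hmax hlong hdα hdβ
        (hn d) (by omega) (by omega) (uncovered_pair hU')) hdα hdβ
    have hcard : ((Finset.range ((ℓ + 1) / 2)).filter fun k =>
        x d (i + ((2 * k : ℕ) : ZMod m)) = false ∧
        x d (i + ((2 * k + 1 : ℕ) : ZMod m)) = false).card ≤ 1 := by
      rw [Finset.card_le_one]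
      intro a ha b hb
      simp only [Finset.mem_filter, Finset.mem_range] at ha hb
      have := e6 a ha.1 ha.2 b hb.1 hb.2
      have := e6 b hb.1 hb.2 a ha.1 ha.2
      omega
    rcases Finset.eq_empty_or_nonempty ((Finset.range ((ℓ + 1) / 2)).filter fun k =>
        x d (i + ((2 * k : ℕ) : ZMod m)) = false ∧
        x d (i + ((2 * k + 1 : ℕ) : ZMod m)) = false) with h0 | ⟨k, hk⟩
    · rw [h0, Finset.card_empty] at hp
      by_cases hx : x d (i + (ℓ : ZMod m)) = true
      · have : ∃ n < ℓ + 1, σ d = some (i + (n : ZMod m)) := by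
          rcases e3 hx with h1 | ⟨a, ha, h1, _⟩
          · exact ⟨_, by omega, h1⟩
          · exact ⟨_, by omega, h1⟩
        rw [if_pos this]
        rw [if_pos hx] at hp
        omega
      · rw [if_neg hx] at hp
        omega
    · simp only [Finset.mem_filter, Finset.mem_range] at hk
      rw [if_pos (e1 k hk.1 hk.2)]
      rw [if_neg (by rw [e5 k hk.1 hk.2]; simp)] at hp
      omega
  -- Summed over the colours, rim edges are counted exactly, but spokes are counted strictly below
  -- `s`, because of the unsaturated vertex `i`.
  have hsum := Finset.sum_le_sum fun d (_ : d ∈ Finset.univ) => key d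
  rw [Finset.sum_const, Finset.card_univ, smul_eq_mul, Finset.sum_add_distrib, h.col.sum_rim,
    ← Finset.card_filter] at hsum
  refine lt_of_le_of_lt hsum (Nat.add_lt_add_left ?_ _)
  calc _ ≤ ∑ n ∈ Finset.range (ℓ + 1), spokeCount σ (i + (n : ZMod m)) := by
        refine le_trans (Finset.card_le_card ?_) (Finset.card_biUnion_le)
        intro d hd
        simpa using hd
    _ < _ := by
        refine Finset.sum_lt_sum (fun n _ => h.col.bound _) ⟨0, by simp, ?_⟩
        rw [Nat.cast_zero, add_zero]; exact h.unsat

/-- The inequality for the whole wheel fails if some colour is crossing. -/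
theorem rim_violated (h : IsAlternating r s N x σ i α β ℓ) (hmax : IsSpokeMax κ r s N)
    (hlong : IsLongest κ r s N ℓ) (hc : Crossing x i α ℓ c) :
    Even m ∧ Fintype.card κ * (m / 2) < ∑ e, r e + ∑ v, s v := by
  classical
  have hodd := h.odd
  have hlt := h.lt
  have heven := h.crossing_even hc
  refine ⟨Nat.even_iff.2 heven, ?_⟩
  have hαv : ∀ k < m / 2, x α (i + ((2 * k : ℕ) : ZMod m)) = false ∧
        x α (i + ((2 * k + 1 : ℕ) : ZMod m)) = false → 2 * k + 1 = ℓ := by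
    intro k hk hU
    rcases lt_trichotomy (2 * k + 1) ℓ with h1 | h1 | h1
    · have := (h.vals h1).1
      rw [hU.2] at this
      simp at this
    · exact h1
    · have := (h.crossing_vals hc (n := 2 * k) (by omega) (by omega)).1
      rw [hU.1] at this
      simp at this
  have hβv : ∀ k < m / 2, x β (i + ((2 * k : ℕ) : ZMod m)) ≠ false := by
    intro k hk
    rw [h.crossing_beta hmax hlong hc (by omega)]
    simp
  -- The same pairing around the whole even rim: each colour has at most one empty pair, and a
  -- colour with an empty pair has a spoke.
  have key : ∀ d, m / 2 ≤ (∑ n ∈ Finset.range m, if x d (i + (n : ZMod m)) = true then 1 else 0) +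
      if σ d ≠ none then 1 else 0 := by
    intro d
    have hp := le_sum_pairs (fun n => x d (i + (n : ZMod m))) (m / 2)
    rw [show 2 * (m / 2) = m by omega] at hp
    have e0 : ∀ k < m / 2, x d (i + ((2 * k : ℕ) : ZMod m)) = false ∧
        x d (i + ((2 * k + 1 : ℕ) : ZMod m)) = false → d ≠ α → d ≠ β → ¬ Crossing x i α ℓ d →
        SpokeOnChain x σ i β d (2 * k + 1) := by
      intro k hk hU hdα hdβ hd
      rcases le_or_gt (2 * k + 1) ℓ with h1 | h1
      · exact h.spokeOnChain_inner hmax hlong hdα hdβ hd (by omega) h1 (uncovered_pair hU)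
      · exact h.spokeOnChain_outer hmax hlong hc hdα hdβ hd (by omega) h1 (by omega)
          (uncovered_pair hU)
    have e1 : ∀ k < m / 2, x d (i + ((2 * k : ℕ) : ZMod m)) = false ∧
        x d (i + ((2 * k + 1 : ℕ) : ZMod m)) = false → σ d ≠ none := by
      intro k hk hU
      by_cases hdα : d = α
      · rw [hdα, h.spoke]; simp
      by_cases hdβ : d = β
      · exact absurd (hdβ ▸ hU.1) (hβv k hk)
      by_cases hd : Crossing x i α ℓ d
      · obtain ⟨_, _, _, _, h1 | h1, _⟩ := h.crossing_spoke hmax hd (v := 2 * k + 1) (by omega)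
          (by omega) (uncovered_pair hU) <;> simp [h1]
      · rcases e0 k hk hU hdα hdβ hd with h1 | ⟨_, _, h1, _⟩ <;> simp [h1]
    have e6 : ∀ k < m / 2, (x d (i + ((2 * k : ℕ) : ZMod m)) = false ∧
        x d (i + ((2 * k + 1 : ℕ) : ZMod m)) = false) → ∀ k' < m / 2,
        (x d (i + ((2 * k' : ℕ) : ZMod m)) = false ∧
        x d (i + ((2 * k' + 1 : ℕ) : ZMod m)) = false) → ¬ k < k' := by
      intro k hk hU k' hk' hU' hlt'
      by_cases hdα : d = α
      · rw [hdα] at hU hU'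
        have := hαv k hk hU
        have := hαv k' hk' hU'
        omega
      by_cases hdβ : d = β
      · exact absurd (hdβ ▸ hU.1) (hβv k hk)
      by_cases hd : Crossing x i α ℓ d
      · exact h.crossing_unique hmax hd (v := 2 * k + 1) (w := 2 * k' + 1) (by omega) (by omega)
          (by omega) (by omega) (uncovered_pair hU) (uncovered_pair hU')
      · refine spokeOnChain_unique (v := 2 * k + 1) (w := 2 * k' + 1) (by omega) (by omega)
          (e0 k hk hU hdα hdβ hd) (e0 k' hk' hU' hdα hdβ hd) (uncovered_pair hU) ?_
        rw [h.crossing_beta hmax hlong hc (by omega)]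
        simp
    rcases Finset.eq_empty_or_nonempty ((Finset.range (m / 2)).filter fun k =>
        x d (i + ((2 * k : ℕ) : ZMod m)) = false ∧
        x d (i + ((2 * k + 1 : ℕ) : ZMod m)) = false) with h0 | ⟨k, hk⟩
    · rw [h0, Finset.card_empty] at hp
      omega
    · have hcard : ((Finset.range (m / 2)).filter fun k =>
          x d (i + ((2 * k : ℕ) : ZMod m)) = false ∧
          x d (i + ((2 * k + 1 : ℕ) : ZMod m)) = false).card ≤ 1 := by
        rw [Finset.card_le_one]
        intro a ha b hb
        simp only [Finset.mem_filter, Finset.mem_range] at ha hb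
        have := e6 a ha.1 ha.2 b hb.1 hb.2
        have := e6 b hb.1 hb.2 a ha.1 ha.2
        omega
      simp only [Finset.mem_filter, Finset.mem_range] at hk
      rw [if_pos (e1 k hk.1 hk.2)]
      omega
  have hsum := Finset.sum_le_sum fun d (_ : d ∈ Finset.univ) => key d
  rw [Finset.sum_const, Finset.card_univ, smul_eq_mul, Finset.sum_add_distrib, h.col.sum_rim,
    ← Finset.card_filter, sum_range_add_natCast] at hsum
  refine lt_of_le_of_lt hsum (Nat.add_lt_add_left ?_ _)
  change spoked σ < _
  rw [spoked_eq_sum]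
  exact Finset.sum_lt_sum (fun n _ => h.col.bound _) ⟨i, by simp, h.unsat⟩

end IsAlternating

/-- A proper edge colouring of the rim of a wheel extends, after recolouring, to the spokes if the
inequalities of the matching polytope hold. -/
theorem exists_colouring_of_rim (hx : ∀ c, IsRimMatching (x c))
    (hr : ∀ e, (Finset.univ.filter fun c => x c e = true).card = r e)
    (hdeg : ∀ v, r (v - 1) + r v + s v ≤ Fintype.card κ)
    (hhub : ∑ v, s v ≤ Fintype.card κ)
    (harc : ∀ (i : ZMod m) (ℓ : ℕ), ℓ < m → ℓ % 2 = 1 →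
      ∑ n ∈ Finset.range ℓ, r (i + (n : ZMod m)) + ∑ n ∈ Finset.range (ℓ + 1), s (i + (n : ZMod m)) ≤
        Fintype.card κ * ((ℓ + 1) / 2))
    (hrim : Even m → ∑ e, r e + ∑ v, s v ≤ Fintype.card κ * (m / 2)) :
    ∃ (x : κ → ZMod m → Bool) (σ : κ → Option (ZMod m)), IsColouring r s x σ ∧
      ∀ v, spokeCount σ v = s v := by
  classical
  obtain ⟨N, ⟨x, σ, hcol, hN⟩, hmax⟩ := exists_greatest_of_le
    (P := fun N => ∃ (x : κ → ZMod m → Bool) (σ : κ → Option (ZMod m)), IsColouring r s x σ ∧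
      spoked σ = N)
    ⟨_, x, fun _ => none, ⟨hx, hr, by simp, fun v => by simp [spokeCount]⟩, rfl⟩
    (Fintype.card κ) (by rintro _ ⟨x, σ, _, rfl⟩; exact Finset.card_le_univ _)
  have hmax : IsSpokeMax κ r s N := fun x σ h => hmax _ ⟨x, σ, h, rfl⟩
  refine ⟨x, σ, hcol, ?_⟩
  by_contra hcon
  push Not at hcon
  obtain ⟨i, hi⟩ := hcon
  have hi : Unsaturated s σ i := lt_of_le_of_ne (hcol.bound i) hi
  -- The hub inequality: some spoke copy is uncoloured, so not every colour can be in use at the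
  -- centre.
  obtain ⟨β, hβ⟩ : ∃ β, σ β = none := by
    by_contra hall
    push Not at hall
    have h1 : spoked σ = Fintype.card κ := by
      unfold spoked
      rw [Finset.filter_true_of_mem (fun c _ => hall c), Finset.card_univ]
    have h2 : spoked σ < ∑ v, s v := by
      rw [spoked_eq_sum]
      exact Finset.sum_lt_sum (fun n _ => hcol.bound _) ⟨i, by simp, hi⟩
    omega
  -- The degree inequality at `i`, where at least one spoke copy is uncoloured.
  obtain ⟨α, hα, hαi⟩ : ∃ α, Uncovered (x α) i ∧ σ α ≠ some i := by
    by_contra hall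
    push Not at hall
    have hsub : (Finset.univ : Finset κ) ⊆ (Finset.univ.filter fun c => x c (i - 1) = true) ∪
        (Finset.univ.filter fun c => x c i = true) ∪ (Finset.univ.filter fun c => σ c = some i) := by
      intro c _
      have := hall c
      unfold Uncovered at this
      simp only [Finset.mem_union, Finset.mem_filter, Finset.mem_univ, true_and]
      grind
    have h1 := Finset.card_le_card hsub
    have h2 := (Finset.card_union_le ((Finset.univ.filter fun c => x c (i - 1) = true) ∪
        (Finset.univ.filter fun c => x c i = true)) (Finset.univ.filter fun c => σ c = some i))
    have h3 := Finset.card_union_le (Finset.univ.filter fun c => x c (i - 1) = true)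
        (Finset.univ.filter fun c => x c i = true)
    rw [hcol.rim, hcol.rim] at h3
    have h4 := hdeg i
    have h5 : (Finset.univ.filter fun c => σ c = some i).card < s i := hi
    rw [Finset.card_univ] at h1
    omega
  have hβi := hcol.not_uncovered hmax hN hi hβ
  obtain ⟨j, hj⟩ : ∃ j, σ α = some j := by
    rw [← Option.ne_none_iff_exists']
    exact fun h' => hcol.not_uncovered hmax hN hi h' hα
  have hji : j ≠ i := by rintro rfl; exact hαi hj
  have hex : ∃ (ℓ : ℕ) (x : κ → ZMod m → Bool) (σ : κ → Option (ZMod m)) (i : ZMod m) (α β : κ),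
      IsAlternating r s N x σ i α β ℓ := by
    by_cases h1 : x β i = true
    · obtain ⟨L, hL⟩ := exists_chain_right (y := x α) (z := x β) (p := i)
        (by rw [hα.2, h1]; simp) (by rw [hα.1, (hcol.matching β).pred h1])
      obtain ⟨⟨σ', h⟩, _⟩ := hcol.exists_alternating hmax hN hi hβ hα hj hji hL (Or.inl rfl)
      exact ⟨_, _, _, _, _, _, h⟩
    · have h1 : x β i = false := by simpa using h1
      have h2 : x β (i - 1) = true := by
        by_contra h2
        exact hβi ⟨by simpa using h2, h1⟩
      obtain ⟨p, L, hL, hp⟩ := exists_chain_left (y := x α) (z := x β) (q := i)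
        (by rw [hα.1, h2]; simp) (by rw [hα.2, h1])
      obtain ⟨⟨σ', h⟩, _⟩ := hcol.exists_alternating hmax hN hi hβ hα hj hji hL (Or.inr hp.symm)
      exact ⟨_, _, _, _, _, _, h⟩
  obtain ⟨ℓ, ⟨x, σ, i, α, β, h⟩, hlong⟩ := exists_greatest_of_le hex m
    (by rintro ℓ ⟨_, _, _, _, _, h⟩; exact h.lt.le)
  have hlong : IsLongest κ r s N ℓ := fun x σ i α β ℓ' h => hlong _ ⟨x, σ, i, α, β, h⟩
  by_cases hc : ∃ c, IsAlternating.Crossing x i α ℓ c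
  · obtain ⟨c, hc⟩ := hc
    obtain ⟨h1, h2⟩ := h.rim_violated hmax hlong hc
    exact absurd (hrim h1) (not_le.2 h2)
  · push Not at hc
    exact absurd (harc i ℓ h.lt h.odd) (not_le.2 (h.arc_violated hmax hlong hc))

end Count

/-! ### Colouring the rim by cyclic intervals. -/

theorem exists_between_sum_eq {ι : Type*} (S : Finset ι) (lo hi : ι → ℕ) (hle : ∀ j, lo j ≤ hi j)
    (N : ℕ) (h1 : ∑ j ∈ S, lo j ≤ N) (h2 : N ≤ ∑ j ∈ S, hi j) :
    ∃ d : ι → ℕ, (∀ j, lo j ≤ d j ∧ d j ≤ hi j) ∧ ∑ j ∈ S, d j = N := by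
  classical
  induction S using Finset.induction_on generalizing N with
  | empty => exact ⟨lo, fun j => ⟨le_rfl, hle j⟩, by simp at h2 ⊢; exact h2.symm⟩
  | insert a S ha ih =>
    rw [Finset.sum_insert ha] at h1 h2
    have hlo : ∑ j ∈ S, lo j ≤ ∑ j ∈ S, hi j := Finset.sum_le_sum fun j _ => hle j
    have h3 := hle a
    obtain ⟨e, he1, he2, he3, he4⟩ : ∃ e, lo a ≤ e ∧ e ≤ hi a ∧ ∑ j ∈ S, lo j + e ≤ N ∧
        N ≤ ∑ j ∈ S, hi j + e := by
      by_cases h : N ≤ ∑ j ∈ S, hi j + lo a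
      · exact ⟨lo a, le_rfl, h3, by omega, h⟩
      · exact ⟨N - ∑ j ∈ S, hi j, by omega, by omega, by omega, by omega⟩
    obtain ⟨d, hd1, hd2⟩ := ih (N - e) (by omega) (by omega)
    refine ⟨Function.update d a e, fun j => ?_, ?_⟩
    · rcases eq_or_ne j a with rfl | hj
      · simpa using ⟨he1, he2⟩
      · rw [Function.update_of_ne hj]; exact hd1 j
    · rw [Finset.sum_insert ha, Function.update_self, Finset.sum_update_of_notMem ha, hd2]
      omega

theorem ZMod.card_sub_val_lt {t : ℕ} [NeZero t] (b : ZMod t) {k : ℕ} (hk : k ≤ t) :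
    (Finset.univ.filter fun c : ZMod t => (c - b).val < k).card = k := by
  refine (Finset.card_bij (s := Finset.range k) (fun n _ => b + (n : ZMod t)) ?_ ?_ ?_).symm.trans
    (Finset.card_range k)
  · intro n hn
    have hn := Finset.mem_range.1 hn
    simp only [Finset.mem_filter, Finset.mem_univ, true_and]
    rw [add_sub_cancel_left, ZMod.val_natCast_of_lt (by omega)]
    exact hn
  · intro a ha c hc h
    have ha := Finset.mem_range.1 ha
    have hc := Finset.mem_range.1 hc
    exact ZMod.add_natCast_inj b (by omega) (by omega) h
  · intro c hc
    simp only [Finset.mem_filter, Finset.mem_univ, true_and] at hc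
    exact ⟨(c - b).val, Finset.mem_range.2 hc, by rw [ZMod.natCast_zmod_val]; ring⟩

/-- A cycle with edge multiplicities has a proper edge colouring with `t` colours if the
inequalities of the matching polytope hold. -/
theorem exists_rim_colouring {m : ℕ} [NeZero m] {t : ℕ} [NeZero t] {r : ZMod m → ℕ}
    (hdeg : ∀ v, r (v - 1) + r v ≤ t) (hrim : ∑ e, r e ≤ t * (m / 2)) :
    ∃ x : ZMod t → ZMod m → Bool, (∀ c, IsRimMatching (x c)) ∧
      ∀ e, (Finset.univ.filter fun c => x c e = true).card = r e := by
  have hdeg' : ∀ v, r v + r (v + 1) ≤ t := fun v => by simpa using hdeg (v + 1)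
  -- Edge `j` will receive `r j` consecutive colours in `ZMod t`, and `d j` is the shift to the
  -- start of the next interval. The bounds `r j ≤ d j ≤ t - r (j + 1)` keep neighbouring intervals
  -- disjoint; the total `t * (m / 2)`, a multiple of `t`, makes the pattern close up around the
  -- cycle.
  obtain ⟨d, hd, hsum⟩ := exists_between_sum_eq Finset.univ r (fun j => t - r (j + 1))
    (fun j => by have := hdeg' j; omega) (t * (m / 2)) hrim (by
      have h1 : ∑ j : ZMod m, (t - r (j + 1)) + ∑ j : ZMod m, r (j + 1) = t * m := by
        rw [← Finset.sum_add_distrib, Finset.sum_congr rfl (g := fun _ => t)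
          (fun j _ => by have := hdeg' j; omega)]
        simp [mul_comm]
      have h2 : ∑ j : ZMod m, r (j + 1) = ∑ j, r j := Equiv.sum_comp (Equiv.addRight 1) r
      have h3 : t * (m / 2) + t * (m / 2) ≤ t * m := by
        rw [← mul_add]; exact Nat.mul_le_mul_left _ (by omega)
      omega)
  set b : ℕ → ZMod t := fun n => ((∑ k ∈ Finset.range n, d (k : ZMod m) : ℕ) : ZMod t) with hb
  have hbm : b m = 0 := by
    have := sum_range_add_natCast (0 : ZMod m) d
    simp only [zero_add] at this
    rw [hb]; simp only [this, hsum]; simp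
  have hstep : ∀ e : ZMod m, b (e + 1).val = b e.val + (d e : ZMod t) := by
    intro e
    have h1 : b (e.val + 1) = b e.val + (d e : ZMod t) := by
      simp only [hb, Finset.sum_range_succ]; push_cast; simp
    rw [← h1]
    have h2 : e.val < m := ZMod.val_lt e
    rcases (show e.val + 1 ≤ m by omega).lt_or_eq with h | h
    · have : (e + 1).val = e.val + 1 := by
        have h3 : e + 1 = ((e.val + 1 : ℕ) : ZMod m) := by push_cast; simp
        rw [h3, ZMod.val_natCast_of_lt h]
      rw [this]
    · have h3 : e + 1 = 0 := by
        have : e + 1 = ((e.val + 1 : ℕ) : ZMod m) := by push_cast; simp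
        rw [this, h]; simp
      rw [h3, ZMod.val_zero, h, hbm]
      simp [hb]
  refine ⟨fun c e => decide ((c - b e.val).val < r e), fun c e he => ?_, fun e => ?_⟩
  · simp only [decide_eq_true_eq, decide_eq_false_iff_not, not_lt] at he ⊢
    obtain ⟨h1, h2⟩ := hd e
    have h3 := hdeg' e
    -- A colour in the interval of `e` has position less than `r e ≤ d e` there, so relative to the
    -- next interval its position is at least `t - d e ≥ r (e + 1)`, with no wrap-around.
    have h4 : c - b (e + 1).val = (((c - b e.val).val + (t - d e) : ℕ) : ZMod t) := by
      rw [hstep]; push_cast [Nat.cast_sub (show d e ≤ t by omega)]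
      simp; ring
    rw [h4, ZMod.val_natCast_of_lt (by omega)]
    omega
  · simpa using ZMod.card_sub_val_lt (b e.val) (k := r e) (by have := hdeg' e; omega)

/-! ### The inequalities for a single matching. -/

section RimSums

variable {m : ℕ} [NeZero m] {ρ ς : ZMod m → ℕ}

theorem rim_sum_le (hdeg : ∀ v, ρ (v - 1) + ρ v + ς v ≤ 1) : ∑ e, ρ e ≤ m / 2 := by
  have h1 : ∑ v : ZMod m, (ρ (v - 1) + ρ v) ≤ ∑ _v : ZMod m, 1 :=
    Finset.sum_le_sum fun v _ => by have := hdeg v; omega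
  have h2 : ∑ v : ZMod m, ρ (v - 1) = ∑ v, ρ v := Equiv.sum_comp (Equiv.subRight 1) ρ
  rw [Finset.sum_add_distrib, h2] at h1
  simp at h1
  omega

/-- Adding the degree bounds of all vertices, the centre included, gives twice the left side at most
`m + 1`; parity does the rest. `arc_sum_le` is the same argument on `ℓ + 1` rim vertices and the
centre. -/
theorem wheel_sum_le (hdeg : ∀ v, ρ (v - 1) + ρ v + ς v ≤ 1) (hhub : ∑ v, ς v ≤ 1) (hm : Even m) :
    ∑ e, ρ e + ∑ v, ς v ≤ m / 2 := by
  have h1 : ∑ v : ZMod m, (ρ (v - 1) + ρ v + ς v) ≤ ∑ _v : ZMod m, 1 :=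
    Finset.sum_le_sum fun v _ => hdeg v
  have h2 : ∑ v : ZMod m, ρ (v - 1) = ∑ v, ρ v := Equiv.sum_comp (Equiv.subRight 1) ρ
  rw [Finset.sum_add_distrib, Finset.sum_add_distrib, h2] at h1
  simp at h1
  have := Nat.even_iff.1 hm
  omega

theorem arc_sum_le (hdeg : ∀ v, ρ (v - 1) + ρ v + ς v ≤ 1) (hhub : ∑ v, ς v ≤ 1) (i : ZMod m)
    {ℓ : ℕ} (hℓ : ℓ < m) (hodd : ℓ % 2 = 1) :
    ∑ n ∈ Finset.range ℓ, ρ (i + (n : ZMod m)) + ∑ n ∈ Finset.range (ℓ + 1), ς (i + (n : ZMod m)) ≤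
      (ℓ + 1) / 2 := by
  have h1 : ∑ n ∈ Finset.range (ℓ + 1), (ρ (i + (n : ZMod m) - 1) + ρ (i + (n : ZMod m)) +
      ς (i + (n : ZMod m))) ≤ ∑ _n ∈ Finset.range (ℓ + 1), 1 :=
    Finset.sum_le_sum fun v _ => hdeg _
  have h2 : ∑ n ∈ Finset.range (ℓ + 1), ρ (i + (n : ZMod m) - 1) =
      ∑ n ∈ Finset.range ℓ, ρ (i + (n : ZMod m)) + ρ (i - 1) := by
    rw [Finset.sum_range_succ']
    simp [← add_assoc]
  have h3 : ∑ n ∈ Finset.range (ℓ + 1), ς (i + (n : ZMod m)) ≤ ∑ v, ς v := by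
    rw [← sum_range_add_natCast i ς]
    exact Finset.sum_le_sum_of_subset (Finset.range_mono (by omega))
  rw [Finset.sum_add_distrib, Finset.sum_add_distrib, h2, Finset.sum_range_succ] at h1
  simp at h1
  omega

end RimSums

/-! ### From matchings to integer points of a dilate. -/

section Polytope

variable {V : Type*} {G : SimpleGraph V} {a : G.edgeSet → ℤ} {t : ℕ}

theorem matchingPolytope_linear_le (g : (G.edgeSet → ℝ) →ₗ[ℝ] ℝ) {B : ℝ}
    (hg : ∀ M : Set G.edgeSet, IsEdgeMatching G M → g (edgeIndicator G M) ≤ B)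
    {z : G.edgeSet → ℝ} (hz : z ∈ (t : ℝ) • matchingPolytope G) : g z ≤ t * B := by
  obtain ⟨y, hy, rfl⟩ := hz
  have hsub : matchingPolytope G ⊆ {y | g y ≤ B} :=
    convexHull_min (by rintro _ ⟨M, hM, rfl⟩; exact hg M hM) (convex_halfSpace_le g.isLinear B)
  have := hsub hy
  simp only [map_smul, smul_eq_mul]
  exact mul_le_mul_of_nonneg_left this (Nat.cast_nonneg t)

open Classical in
theorem sum_le_of_mem_matchingPolytope (ha : latticePoint a ∈ (t : ℝ) • matchingPolytope G)
    {ι : Type*} (J : Finset ι) (f : ι → G.edgeSet) (B : ℕ)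
    (hB : ∀ M : Set G.edgeSet, IsEdgeMatching G M → ∑ j ∈ J, (if f j ∈ M then 1 else 0) ≤ B) :
    ∑ j ∈ J, a (f j) ≤ t * B := by
  have := matchingPolytope_linear_le (∑ j ∈ J, LinearMap.proj (f j)) (B := B) (fun M hM => by
    have := hB M hM
    simp only [LinearMap.sum_apply, LinearMap.proj_apply, edgeIndicator, Set.indicator_apply]
    exact_mod_cast this) ha
  simp only [LinearMap.sum_apply, LinearMap.proj_apply, latticePoint] at this
  exact_mod_cast this

theorem nonneg_of_mem_matchingPolytope (ha : latticePoint a ∈ (t : ℝ) • matchingPolytope G)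
    (e : G.edgeSet) : 0 ≤ a e := by
  have := matchingPolytope_linear_le (-LinearMap.proj e) (B := 0) (fun M _ => by
    classical
    simp only [LinearMap.neg_apply, LinearMap.proj_apply, edgeIndicator, Set.indicator_apply]
    split_ifs <;> simp) ha
  simp only [LinearMap.neg_apply, LinearMap.proj_apply, latticePoint, mul_zero,
    Left.neg_nonpos_iff] at this
  exact_mod_cast this

open Classical in
theorem edgeIndicator_eq_latticePoint (M : Set G.edgeSet) :
    edgeIndicator G M = latticePoint fun e => if e ∈ M then 1 else 0 := by
  funext e
  simp [edgeIndicator, latticePoint, Set.indicator_apply]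

theorem isLatticePolytope_matchingPolytope [Finite G.edgeSet] :
    IsLatticePolytope (matchingPolytope G) := by
  classical
  refine ⟨(fun M e => if e ∈ M then 1 else 0) '' {M : Set G.edgeSet | IsEdgeMatching G M},
    Set.Finite.image _ (Set.toFinite _), ?_⟩
  unfold matchingPolytope
  congr 1
  ext z
  constructor
  · rintro ⟨M, hM, rfl⟩
    exact ⟨_, ⟨M, hM, rfl⟩, (edgeIndicator_eq_latticePoint M).symm⟩
  · rintro ⟨_, ⟨M, hM, rfl⟩, rfl⟩
    exact ⟨M, hM, (edgeIndicator_eq_latticePoint M).symm⟩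

end Polytope

/-! ### The edges of the wheel and its matchings. -/

section Wheel

variable {n : ℕ}

theorem ZMod.natCast_ne_zero_of_lt {m k : ℕ} (h0 : 0 < k) (h : k < m) : (k : ZMod m) ≠ 0 := by
  rw [Ne, ZMod.natCast_eq_zero_iff]
  exact Nat.not_dvd_of_pos_of_lt h0 h

/-- The rim edge `{i, i + 1}` of the wheel. -/
def rimEdge (hn : 4 ≤ n) (i : ZMod (n - 1)) : (wheelGraph n).edgeSet :=
  ⟨s(Sum.inl i, Sum.inl (i + 1)), by
    have := ZMod.natCast_ne_zero_of_lt (m := n - 1) (k := 1) (by omega) (by omega)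
    rw [wheelGraph, SimpleGraph.edgeSet_fromEdgeSet]
    exact ⟨⟨i, Or.inl rfl⟩, by simpa using this⟩⟩

/-- The spoke at `i` of the wheel. -/
def spokeEdge (n : ℕ) (i : ZMod (n - 1)) : (wheelGraph n).edgeSet :=
  ⟨s(Sum.inl i, Sum.inr ()), by
    rw [wheelGraph, SimpleGraph.edgeSet_fromEdgeSet]
    exact ⟨⟨i, Or.inr rfl⟩, by simp⟩⟩

theorem wheel_edge_cases (hn : 4 ≤ n) (e : (wheelGraph n).edgeSet) :
    (∃ i, e = rimEdge hn i) ∨ ∃ i, e = spokeEdge n i := by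
  obtain ⟨e, he⟩ := e
  have he' := he
  rw [wheelGraph, SimpleGraph.edgeSet_fromEdgeSet] at he'
  obtain ⟨⟨i, rfl | rfl⟩, _⟩ := he'
  · exact Or.inl ⟨i, rfl⟩
  · exact Or.inr ⟨i, rfl⟩

/-- Two rim edges could coincide with reversed ends only if `2 = 0` in `ZMod (n - 1)`; this is where
the rim must have at least three vertices. -/
theorem rimEdge_injective (hn : 4 ≤ n) : Function.Injective (rimEdge hn) := by
  intro i j h
  have h := congrArg Subtype.val h
  simp only [rimEdge, Sym2.eq_iff, Sum.inl.injEq] at h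
  rcases h with h | ⟨h1, h2⟩
  · exact h.1
  · exfalso
    refine ZMod.natCast_ne_zero_of_lt (m := n - 1) (k := 2) (by omega) (by omega) ?_
    rw [h1] at h2
    push_cast
    linear_combination h2

theorem spokeEdge_injective (n : ℕ) : Function.Injective (spokeEdge n) := by
  intro i j h
  have h := congrArg Subtype.val h
  simpa [spokeEdge] using h

theorem rimEdge_ne_spokeEdge (hn : 4 ≤ n) (i j : ZMod (n - 1)) : rimEdge hn i ≠ spokeEdge n j := by
  intro h
  have h := congrArg Subtype.val h
  simp [spokeEdge, rimEdge] at h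

theorem inl_mem_rimEdge (hn : 4 ≤ n) {v i : ZMod (n - 1)} :
    Sum.inl v ∈ (rimEdge hn i : Sym2 (ZMod (n - 1) ⊕ Unit)) ↔ v = i ∨ v = i + 1 := by
  simp [rimEdge]

theorem inl_mem_spokeEdge {v i : ZMod (n - 1)} :
    Sum.inl v ∈ (spokeEdge n i : Sym2 (ZMod (n - 1) ⊕ Unit)) ↔ v = i := by
  simp [spokeEdge]

theorem inr_mem_spokeEdge {u : Unit} {i : ZMod (n - 1)} :
    Sum.inr u ∈ (spokeEdge n i : Sym2 (ZMod (n - 1) ⊕ Unit)) := by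
  simp [spokeEdge]

theorem inr_notMem_rimEdge (hn : 4 ≤ n) {u : Unit} {i : ZMod (n - 1)} :
    Sum.inr u ∉ (rimEdge hn i : Sym2 (ZMod (n - 1) ⊕ Unit)) := by
  simp [rimEdge]

/-- The set of edges of the wheel given by a set of rim edges and at most one spoke. -/
def wheelEdges (hn : 4 ≤ n) (y : ZMod (n - 1) → Bool) (w : Option (ZMod (n - 1))) :
    Set (wheelGraph n).edgeSet :=
  {e | (∃ i, e = rimEdge hn i ∧ y i = true) ∨ ∃ i, e = spokeEdge n i ∧ w = some i}

theorem rimEdge_mem_wheelEdges (hn : 4 ≤ n) {y : ZMod (n - 1) → Bool} {w : Option (ZMod (n - 1))}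
    {i : ZMod (n - 1)} : rimEdge hn i ∈ wheelEdges hn y w ↔ y i = true := by
  simp [wheelEdges, rimEdge_ne_spokeEdge, (rimEdge_injective hn).eq_iff]

theorem spokeEdge_mem_wheelEdges (hn : 4 ≤ n) {y : ZMod (n - 1) → Bool}
    {w : Option (ZMod (n - 1))} {i : ZMod (n - 1)} :
    spokeEdge n i ∈ wheelEdges hn y w ↔ w = some i := by
  simp [wheelEdges, (rimEdge_ne_spokeEdge hn _ _).symm, (spokeEdge_injective n).eq_iff]

theorem isEdgeMatching_wheelEdges (hn : 4 ≤ n) {y : ZMod (n - 1) → Bool}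
    {w : Option (ZMod (n - 1))} (hy : IsRimMatching y) (hw : ∀ v, w = some v → Uncovered y v) :
    IsEdgeMatching (wheelGraph n) (wheelEdges hn y w) := by
  rintro (v | u) e he f hf hue huf
  · rcases he with ⟨i, rfl, hi⟩ | ⟨i, rfl, hi⟩ <;> rcases hf with ⟨j, rfl, hj⟩ | ⟨j, rfl, hj⟩
    · rw [inl_mem_rimEdge] at hue huf
      have h1 := hy i hi
      have h2 := hy j hj
      rcases hue with rfl | rfl <;> rcases huf with h | h
      · rw [h]
      · subst h; simp [hi] at h2
      · subst h; simp [hj] at h1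
      · rw [add_right_cancel h]
    · rw [inl_mem_rimEdge] at hue
      rw [inl_mem_spokeEdge] at huf
      subst huf
      have := hw _ hj
      rcases hue with rfl | rfl
      · simp [this.2] at hi
      · have := this.1; simp [hi] at this
    · rw [inl_mem_rimEdge] at huf
      rw [inl_mem_spokeEdge] at hue
      subst hue
      have := hw _ hi
      rcases huf with rfl | rfl
      · simp [this.2] at hj
      · have := this.1; simp [hj] at this
    · rw [Option.some.inj (hi.symm.trans hj)]
  · rcases he with ⟨i, rfl, hi⟩ | ⟨i, rfl, hi⟩
    · exact absurd hue (inr_notMem_rimEdge hn)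
    rcases hf with ⟨j, rfl, hj⟩ | ⟨j, rfl, hj⟩
    · exact absurd huf (inr_notMem_rimEdge hn)
    rw [Option.some.inj (hi.symm.trans hj)]

open Classical in
theorem IsEdgeMatching.degree_le (hn : 4 ≤ n) {M : Set (wheelGraph n).edgeSet}
    (hM : IsEdgeMatching (wheelGraph n) M) (v : ZMod (n - 1)) :
    (if rimEdge hn (v - 1) ∈ M then 1 else 0) + (if rimEdge hn v ∈ M then 1 else 0) +
      (if spokeEdge n v ∈ M then 1 else 0) ≤ 1 := by
  have h1 : Sum.inl v ∈ (rimEdge hn (v - 1) : Sym2 (ZMod (n - 1) ⊕ Unit)) := by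
    simp [inl_mem_rimEdge]
  have h2 : Sum.inl v ∈ (rimEdge hn v : Sym2 (ZMod (n - 1) ⊕ Unit)) := by
    simp [inl_mem_rimEdge]
  have h3 : Sum.inl v ∈ (spokeEdge n v : Sym2 (ZMod (n - 1) ⊕ Unit)) := by
    simp [inl_mem_spokeEdge]
  have h12 : rimEdge hn (v - 1) ≠ rimEdge hn v := by
    intro h
    have := rimEdge_injective hn h
    have h0 := ZMod.natCast_ne_zero_of_lt (m := n - 1) (k := 1) (by omega) (by omega)
    rw [sub_eq_self] at this
    simp [this] at h0
  have k1 := fun a b => h12 (hM _ _ a _ b h1 h2)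
  have k2 := fun a b => rimEdge_ne_spokeEdge hn _ _ (hM _ _ a _ b h1 h3)
  have k3 := fun a b => rimEdge_ne_spokeEdge hn _ _ (hM _ _ a _ b h2 h3)
  split_ifs <;> simp_all

open Classical in
theorem IsEdgeMatching.hub_le [NeZero (n - 1)] {M : Set (wheelGraph n).edgeSet}
    (hM : IsEdgeMatching (wheelGraph n) M) :
    ∑ v, (if spokeEdge n v ∈ M then 1 else 0) ≤ 1 := by
  rw [← Finset.card_filter, Finset.card_le_one]
  intro v hv w hw
  simp only [Finset.mem_filter, Finset.mem_univ, true_and] at hv hw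
  exact spokeEdge_injective n (hM (Sum.inr ()) _ hv _ hw inr_mem_spokeEdge inr_mem_spokeEdge)

end Wheel

/-! ### Assembly: inequalities, colouring, decomposition. -/

theorem mainTheorem3 (n : ℕ) (hn : 4 ≤ n) : HasIDP (matchingPolytope (wheelGraph n)) := by
  classical
  have : NeZero (n - 1) := ⟨by omega⟩
  refine ⟨isLatticePolytope_matchingPolytope, fun t ht a ha => ?_⟩
  have : NeZero t := ⟨by omega⟩
  obtain ⟨r, hr⟩ : ∃ r : ZMod (n - 1) → ℕ, ∀ i, (r i : ℤ) = a (rimEdge hn i) :=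
    ⟨fun i => (a (rimEdge hn i)).toNat,
      fun i => Int.toNat_of_nonneg (nonneg_of_mem_matchingPolytope ha _)⟩
  obtain ⟨s, hs⟩ : ∃ s : ZMod (n - 1) → ℕ, ∀ i, (s i : ℤ) = a (spokeEdge n i) :=
    ⟨fun i => (a (spokeEdge n i)).toNat,
      fun i => Int.toNat_of_nonneg (nonneg_of_mem_matchingPolytope ha _)⟩
  have hdeg : ∀ v, r (v - 1) + r v + s v ≤ t := by
    intro v
    have := sum_le_of_mem_matchingPolytope ha Finset.univ
      ![rimEdge hn (v - 1), rimEdge hn v, spokeEdge n v] 1 (fun M hM => by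
        rw [Fin.sum_univ_three]; exact hM.degree_le hn v)
    simp only [Fin.sum_univ_three, Matrix.cons_val, ← hr, ← hs] at this
    push_cast at this
    omega
  have hhub : ∑ v, s v ≤ t := by
    have := sum_le_of_mem_matchingPolytope ha Finset.univ (spokeEdge n) 1 (fun M hM => hM.hub_le)
    simp only [← hs] at this
    rw [Nat.cast_one, mul_one] at this
    exact_mod_cast this
  have hrim : ∑ e, r e ≤ t * ((n - 1) / 2) := by
    have := sum_le_of_mem_matchingPolytope ha Finset.univ (rimEdge hn) ((n - 1) / 2)
      (fun M hM => rim_sum_le (hM.degree_le hn))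
    simp only [← hr] at this
    exact_mod_cast this
  have hwheel : Even (n - 1) → ∑ e, r e + ∑ v, s v ≤ t * ((n - 1) / 2) := by
    intro heven
    have := sum_le_of_mem_matchingPolytope ha
      ((Finset.univ : Finset (ZMod (n - 1))).disjSum (Finset.univ : Finset (ZMod (n - 1))))
      (Sum.elim (rimEdge hn) (spokeEdge n)) ((n - 1) / 2) (fun M hM => by
        rw [Finset.sum_disjSum]
        exact wheel_sum_le (hM.degree_le hn) hM.hub_le heven)
    rw [Finset.sum_disjSum] at this
    simp only [Sum.elim_inl, Sum.elim_inr, ← hr, ← hs] at this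
    exact_mod_cast this
  have harc : ∀ (i : ZMod (n - 1)) (ℓ : ℕ), ℓ < n - 1 → ℓ % 2 = 1 →
      ∑ k ∈ Finset.range ℓ, r (i + (k : ZMod (n - 1))) +
        ∑ k ∈ Finset.range (ℓ + 1), s (i + (k : ZMod (n - 1))) ≤ t * ((ℓ + 1) / 2) := by
    intro i ℓ hℓ hodd
    have := sum_le_of_mem_matchingPolytope ha
      ((Finset.range ℓ).disjSum (Finset.range (ℓ + 1)))
      (Sum.elim (fun k => rimEdge hn (i + (k : ZMod (n - 1))))
        (fun k => spokeEdge n (i + (k : ZMod (n - 1))))) ((ℓ + 1) / 2) (fun M hM => by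
        rw [Finset.sum_disjSum]
        exact arc_sum_le (ρ := fun e => if rimEdge hn e ∈ M then 1 else 0)
          (ς := fun v => if spokeEdge n v ∈ M then 1 else 0) (hM.degree_le hn) hM.hub_le i hℓ hodd)
    rw [Finset.sum_disjSum] at this
    simp only [Sum.elim_inl, Sum.elim_inr, ← hr, ← hs] at this
    exact_mod_cast this
  obtain ⟨x₀, hx₀, hx₀r⟩ := exists_rim_colouring (t := t) (fun v => by have := hdeg v; omega) hrim
  obtain ⟨x, σ, hcol, hσ⟩ := exists_colouring_of_rim (s := s) hx₀ hx₀r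
    (by simpa [ZMod.card] using hdeg) (by simpa [ZMod.card] using hhub)
    (by simpa [ZMod.card] using harc) (by simpa [ZMod.card] using hwheel)
  let eq : Fin t ≃ ZMod t := Fintype.equivOfCardEq (by simp [ZMod.card])
  -- The summands are the indicator vectors of the colour classes. They add up to `a` because each
  -- edge is used by as many colours as its multiplicity.
  refine ⟨fun k e => if e ∈ wheelEdges hn (x (eq k)) (σ (eq k)) then 1 else 0, fun k => ?_, ?_⟩
  · rw [← edgeIndicator_eq_latticePoint]
    exact subset_convexHull ℝ _
      ⟨_, isEdgeMatching_wheelEdges hn (hcol.matching _) (hcol.free _), rfl⟩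
  · funext e
    rw [Finset.sum_apply,
      Equiv.sum_comp eq fun c => if e ∈ wheelEdges hn (x c) (σ c) then (1 : ℤ) else 0]
    rcases wheel_edge_cases hn e with ⟨i, rfl⟩ | ⟨i, rfl⟩
    · simp only [rimEdge_mem_wheelEdges]
      rw [← hr, ← hcol.rim, Finset.card_filter]
      push_cast
      rfl
    · simp only [spokeEdge_mem_wheelEdges]
      rw [← hs, ← hσ, spokeCount, Finset.card_filter]
      push_cast
      rfl
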